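/- Corollary 4.12. Place the infinite hexagonal lattice (regular hexagons of side length one) in the plane so that some of its edges are vertical. A hexagonal system $H$ is the plane graph formed by a cycle of this lattice together with its interior; it is Kekuléan if it has a perfect matching. For a perfect matching $M$ of $H$, a proper sextet is a hexagon of $H$ whose edges belong alternately to $M$ and not to $M$ and whose vertical edge in $M$ is the right one of its two vertical edges; $a(H,i)$ denotes the number of perfect matchings of $H$ with exactly $i$ proper sextets. The resonance graph $R(H)$ has the perfect matchings of $H$ as vertices, two of them being adjacent if their symmetric difference is the edge set of a hexagon of $H$. Let $G$ be a graph whose components are median graphs. Two edges $ab$ and $xy$ of $G$ in the same component are in relation $\Theta$ if $d(a,x)+d(b,y)\neq d(a,y)+d(b,x)$; this is an equivalence relation on the edges of $G$. For an edge $ab$ let $W_{ab}$ be the set of vertices in the component of $a$ that are closer to $a$ than to $b$, and let $U_{ab}$ be the subgraph of $G$ induced by the vertices of $W_{ab}$ that have a neighbour in $W_{ba}$. Up to isomorphism, $U_{ab}$ depends only on the $\Theta$-class of the edge $ab$. The derivative $\partial G$ is the disjoint union of the graphs $U_{ab}$, taking one edge $ab$ from each $\Theta$-class; its components are again median graphs.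 Put $\partial^0G=G$ and $\partial^{i+1}G=\partial(\partial^iG)$, and let $\theta_i(G)$ be the number of connected components of $\partial^iG$. For every Kekuléan hexagonal system $H$ (whose resonance graph is known to be a median graph) and every integer $i\ge 0$, $$i!\,a(H,i)=\theta_i(R(H)).$$ -/

import Mathlib

/-! ## The hexagonal lattice, hexagonal systems and resonance graphs -/

namespace Benzenoid

/-- The infinite hexagonal lattice (all hexagons regular of side length one, some edges vertical).
The vertex `(x, y)` stands for the point of the plane with abscissa `x * √3 / 2` and ordinate
`3 * y / 2 + 1 / 4` if `x + y` is even, `3 * y / 2 - 1 / 4` if `x + y` is odd.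
Two vertices are adjacent iff their points are at distance one: every vertex is joined to
`(x - 1, y)` and `(x + 1, y)` by slanted edges, and `(x, y)` with `x + y` even is joined to
`(x, y + 1)` by a vertical edge. -/
def hexLattice : SimpleGraph (ℤ × ℤ) where
  Adj u v :=
    (u.2 = v.2 ∧ (v.1 = u.1 + 1 ∨ u.1 = v.1 + 1)) ∨
    (u.1 = v.1 ∧ ((v.2 = u.2 + 1 ∧ Even (u.1 + u.2)) ∨ (u.2 = v.2 + 1 ∧ Even (v.1 + v.2))))
  symm := ⟨by
    rintro u v (⟨h, h'⟩ | ⟨h, h'⟩)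
    · exact Or.inl ⟨h.symm, h'.symm⟩
    · exact Or.inr ⟨h.symm, h'.symm⟩⟩
  loopless := ⟨by
    rintro u (⟨_, h⟩ | ⟨_, h⟩)
    · omega
    · omega⟩

/-- The hexagonal faces of the lattice are indexed by `ℤ × ℤ`. `hexVertex h j`, `j = 0, …, 5`, are
the corners of the face `h` in counterclockwise order, starting from the lower end of its left
vertical side: lower left, bottom, lower right, upper right, top, upper left. -/
def hexVertex (h : ℤ × ℤ) : Fin 6 → ℤ × ℤ :=
  ![(2 * h.1 + h.2, h.2), (2 * h.1 + h.2 + 1, h.2), (2 * h.1 + h.2 + 2, h.2),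
    (2 * h.1 + h.2 + 2, h.2 + 1), (2 * h.1 + h.2 + 1, h.2 + 1), (2 * h.1 + h.2, h.2 + 1)]

/-- The sides of the face `h` in cyclic order (the index is taken modulo `6`); side `2` is the
right vertical side, side `5` is the left vertical side. -/
def hexEdge (h : ℤ × ℤ) (j : Fin 6) : Sym2 (ℤ × ℤ) :=
  s(hexVertex h j, hexVertex h (j + 1))

/-- The edge set of the hexagon `h`. -/
def hexEdges (h : ℤ × ℤ) : Set (Sym2 (ℤ × ℤ)) := Set.range (hexEdge h)

theorem hexLattice_adj_hexVertex (h : ℤ × ℤ) (j : Fin 6) :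
    hexLattice.Adj (hexVertex h j) (hexVertex h (j + 1)) := by
  have e : Even (2 * h.1 + h.2 + h.2) := ⟨h.1 + h.2, by ring⟩
  have e' : Even (2 * h.1 + h.2 + 2 + h.2) := ⟨h.1 + h.2 + 1, by ring⟩
  fin_cases j <;> simp [hexLattice, hexVertex, e, e'] <;> omega

theorem hexEdges_subset (h : ℤ × ℤ) : hexEdges h ⊆ hexLattice.edgeSet := by
  rintro _ ⟨j, rfl⟩
  exact hexLattice_adj_hexVertex h j

/-- The hexagon `h` as a subgraph of the lattice. -/
def hexagon (h : ℤ × ℤ) : hexLattice.Subgraph where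
  verts := Set.range (hexVertex h)
  Adj u v := s(u, v) ∈ hexEdges h
  adj_sub := fun huv => hexEdges_subset h huv
  edge_vert := by
    rintro u v ⟨j, hj⟩
    rcases Sym2.eq_iff.1 hj with ⟨h1, _⟩ | ⟨_, h1⟩
    · exact ⟨j, h1⟩
    · exact ⟨j + 1, h1⟩
  symm := ⟨fun u v huv => by rw [Sym2.eq_swap]; exact huv⟩

/-- The faces of the lattice, two of them being adjacent if one can step from one to the other
through a common side that is not in the edge set `C`. -/
def faceGraphOff (C : Set (Sym2 (ℤ × ℤ))) : SimpleGraph (ℤ × ℤ) where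
  Adj h k := h ≠ k ∧ ∃ e, e ∈ hexEdges h ∧ e ∈ hexEdges k ∧ e ∉ C
  symm := ⟨fun _ _ hk => ⟨hk.1.symm, hk.2.imp fun _ he => ⟨he.2.1, he.1, he.2.2⟩⟩⟩
  loopless := ⟨fun _ hk => hk.1 rfl⟩

/-- The faces in the interior of a cycle with edge set `C`: those lying in a bounded region of the
complement of `C`, i.e. from which only finitely many faces can be reached without crossing `C`. -/
def interiorFaces (C : Set (Sym2 (ℤ × ℤ))) : Set (ℤ × ℤ) :=
  {h | {k | (faceGraphOff C).Reachable h k}.Finite}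

/-- A hexagonal system: a cycle of the hexagonal lattice together with its interior. -/
def IsHexagonalSystem (H : hexLattice.Subgraph) : Prop :=
  ∃ (v : ℤ × ℤ) (c : hexLattice.Walk v v), c.IsCycle ∧
    H = c.toSubgraph ⊔ ⨆ h ∈ interiorFaces {e | e ∈ c.edges}, hexagon h

/-- Perfect matchings (Kekulé structures) of `H`: matchings contained in `H` that cover every
vertex of `H`. -/
abbrev PerfectMatching (H : hexLattice.Subgraph) : Type :=
  {M : hexLattice.Subgraph // M ≤ H ∧ M.verts = H.verts ∧ M.IsMatching}

/-- `H` is Kekuléan if it has a perfect matching. -/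
def IsKekulean (H : hexLattice.Subgraph) : Prop := Nonempty (PerfectMatching H)

/-- The resonance graph `R(H)`: its vertices are the perfect matchings of `H`, two of them being
adjacent if their symmetric difference is the edge set of a hexagon of `H`. -/
def resonanceGraph (H : hexLattice.Subgraph) : SimpleGraph (PerfectMatching H) where
  Adj M N := ∃ h, hexagon h ≤ H ∧ symmDiff M.1.edgeSet N.1.edgeSet = hexEdges h
  symm := ⟨fun _ _ ⟨h, hH, hs⟩ => ⟨h, hH, by rw [symmDiff_comm]; exact hs⟩⟩
  loopless := ⟨fun M ⟨h, _, hs⟩ => by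
    rw [symmDiff_self] at hs
    exact (Set.range_nonempty (hexEdge h)).ne_empty hs.symm⟩

/-- The sides of the hexagon `h` belong alternately to `M` and not to `M`. -/
def IsAlternating (M : hexLattice.Subgraph) (h : ℤ × ℤ) : Prop :=
  ∀ j : Fin 6, hexEdge h j ∈ M.edgeSet ↔ hexEdge h (j + 1) ∉ M.edgeSet

/-- A proper sextet of the perfect matching `M`: an `M`-alternating hexagon of `H` whose vertical
edge in `M` is the right one. -/
def IsProperSextet (H : hexLattice.Subgraph) (M : PerfectMatching H) (h : ℤ × ℤ) : Prop :=
  hexagon h ≤ H ∧ IsAlternating M.1 h ∧ hexEdge h 2 ∈ M.1.edgeSet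

/-- `a(H, i)`: the number of perfect matchings of `H` with exactly `i` proper sextets. -/
noncomputable def numMatchingsWithProperSextets (H : hexLattice.Subgraph) (i : ℕ) : ℕ :=
  Nat.card {M : PerfectMatching H // {h | IsProperSextet H M h}.ncard = i}

end Benzenoid

/-! ## Derivatives of (disjoint unions of) median graphs -/

namespace CubeDerivative

universe u

variable {V : Type u}

/-- The Djoković–Winkler relation `Θ` on the edges of `G`: `ab Θ xy` iff
`d(a, x) + d(b, y) ≠ d(a, y) + d(b, x)`. (Edges in different components are not related, since
`SimpleGraph.dist` is `0` for vertices in different components.) -/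
def Theta (G : SimpleGraph V) (e f : G.edgeSet) : Prop :=
  ∃ a b x y, e.1 = s(a, b) ∧ f.1 = s(x, y) ∧
    G.dist a x + G.dist b y ≠ G.dist a y + G.dist b x

/-- The `Θ`-classes of `G`. (In a graph whose components are median graphs `Θ` is an equivalence
relation; in general these are the classes of its transitive closure.) -/
def ThetaClass (G : SimpleGraph V) : Type u := Quot (Theta G)

/-- `W_{ab}`: the vertices closer to `a` than to `b`. (For adjacent `a`, `b` these lie in the
component of `a`, as both distances are `0` for vertices in other components.) -/
def W (G : SimpleGraph V) (a b : V) : Set V := {x | G.dist x a < G.dist x b}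

/-- `U_{ab}`: the vertices of `W_{ab}` that have a neighbour in `W_{ba}`. -/
def U (G : SimpleGraph V) (a b : V) : Set V := {x | x ∈ W G a b ∧ ∃ y ∈ W G b a, G.Adj x y}

/-- An edge `ab` of the `Θ`-class `F`, with its ends in some order. -/
noncomputable def ThetaClass.rep {G : SimpleGraph V} (F : ThetaClass G) : V × V :=
  Quot.out (Quot.out F : G.edgeSet).1

/-- The vertices of the derivative graph: pairs of a `Θ`-class `F` and a vertex of `U_{ab}`, where
`ab` is an edge of `F`. -/
def DerivVertex (G : SimpleGraph V) : Type u :=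
  {p : ThetaClass G × V // p.2 ∈ U G p.1.rep.1 p.1.rep.2}

/-- The derivative graph `∂G`: the disjoint union, over all `Θ`-classes `F` of `G`, of the subgraph
of `G` induced by `U_{ab}`, where `ab` is an edge of `F`. (If the components of `G` are median
graphs, this subgraph depends, up to isomorphism, neither on the choice of the edge `ab` in `F` nor
on the order of its ends, and its components are median graphs.) -/
def deriv (G : SimpleGraph V) : SimpleGraph (DerivVertex G) where
  Adj p q := p.1.1 = q.1.1 ∧ G.Adj p.1.2 q.1.2
  symm := ⟨fun _ _ h => ⟨h.1.symm, h.2.symm⟩⟩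
  loopless := ⟨fun p h => G.loopless.irrefl p.1.2 h.2⟩

/-- The higher derivative graph `∂^i G` together with its vertex type:
`∂^0 G = G` and `∂^(i+1) G = ∂(∂^i G)`. -/
def iterDeriv (G : SimpleGraph V) : ℕ → (W : Type u) × SimpleGraph W
  | 0 => ⟨V, G⟩
  | i + 1 => ⟨DerivVertex (iterDeriv G i).2, deriv (iterDeriv G i).2⟩

/-- `θ_i(G)`: the number of connected components of `∂^i G`. -/
noncomputable def theta (G : SimpleGraph V) (i : ℕ) : ℕ :=
  Nat.card (iterDeriv G i).2.ConnectedComponent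

end CubeDerivative

/-! The resonance graph is the cover graph of a finite distributive lattice in which the lower
covers of a perfect matching correspond to its proper sextets. The theorem then reduces to a count
of antichains.

Geometry. Fix a perfect matching with indicator function `m` on the bonds. The difference of two
indicator functions sums to zero at every vertex, so it is the coboundary of a finitely supported
height function on the faces; since `H` has no holes, the height vanishes at faces outside `H`
(`ofHeight_surjective`). Heights are closed under pointwise maximum and minimum, hence form a
distributive lattice. Lowering a height by one at a single face is allowed exactly when that face is
a proper sextet (`isProperSextet_iff`), and these moves are exactly the cover relations
(`covBy_iff`). The hard point is that whenever `ψ < φ` some such move leads from `φ` towards `ψ`: on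
the set where `φ - ψ` is maximal there must be a proper sextet, since otherwise one could circulate
inside this set across bonds not in the matching. `no_cyclic_flow` excludes this: such a flow is a
difference of vertex potentials, and pairing it with `m` and with the constant `1` shows that its
total mass is zero.

Combinatorics. By Birkhoff's theorem the lattice consists of the down-sets of a finite poset `P`.
Distance between down-sets is the size of the symmetric difference, so a `Θ`-class consists of the
edges toggling one element `p`, and `U_{ab}` is the graph of down-sets of the elements incomparable
to `p` (`derivIso`). Iterating, the components of the `i`-th derivative correspond to ordered
sequences of `i` pairwise incomparable elements, so there are `i!` for each antichain of size `i`
(`theta_eq_factorial_mul_card_antichains`). Antichains of size `i` match down-sets with `i` maximal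
elements, that is, with `i` lower covers. -/

set_option linter.unusedSectionVars false

/-! ## Graphs of down-sets and their derivatives -/

namespace DownSetGraph

open Finset CubeDerivative

variable {κ P : Type} [PartialOrder P] [DecidableEq P]

/-- `A` is a down-set of the finite ordered set `Q`. -/
def IsDown (Q A : Finset P) : Prop := A ⊆ Q ∧ ∀ p ∈ A, ∀ q ∈ Q, q ≤ p → q ∈ A

/-- The disjoint union of the families of down-sets of the ordered sets `Q k`. -/
structure DownSet (Q : κ → Finset P) where
  idx : κ
  set : Finset P
  isDown : IsDown (Q idx) set

/-- The disjoint union of the cover graphs of the lattices of down-sets of the `Q k`. -/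
def downGraph (Q : κ → Finset P) : SimpleGraph (DownSet Q) where
  Adj x y := x.idx = y.idx ∧ ∃ p, symmDiff x.set y.set = {p}
  symm := ⟨fun _ _ h => ⟨h.1.symm, h.2.imp fun _ hp => by rw [symmDiff_comm]; exact hp⟩⟩
  loopless := ⟨fun x ⟨_, p, hp⟩ => by
    rw [symmDiff_self] at hp
    exact (singleton_ne_empty p) hp.symm⟩

theorem DownSet.ext' {Q : κ → Finset P} {x y : DownSet Q} (h : x.idx = y.idx)
    (h' : x.set = y.set) : x = y := by
  cases x; cases y; cases h; cases h'; rfl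

theorem mem_iff_of_symmDiff_singleton {A B : Finset P} {p : P} (h : symmDiff A B = {p}) (q : P) :
    (q ∈ B ↔ q ∈ A) ↔ q ≠ p := by
  have := Finset.ext_iff.1 h q
  rw [mem_symmDiff, mem_singleton] at this
  tauto

/-- Toggling `p` changes the Hamming distance to `X` by one, with sign decided by whether `A` agrees
with `X` at `p`. All distance comparisons below reduce to this. -/
theorem card_symmDiff_toggle {A B X : Finset P} {p : P} (h : symmDiff A B = {p}) :
    ((p ∈ A ↔ p ∈ X) → (symmDiff B X).card = (symmDiff A X).card + 1) ∧
    (¬ (p ∈ A ↔ p ∈ X) → (symmDiff B X).card + 1 = (symmDiff A X).card) := by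
  have hB : ∀ q, q ∈ symmDiff B X ↔ (q ∈ symmDiff A X ↔ q ≠ p) := by
    intro q
    have := mem_iff_of_symmDiff_singleton h q
    simp only [mem_symmDiff]
    tauto
  constructor
  · intro hp
    have : symmDiff B X = insert p (symmDiff A X) := by
      ext q
      rw [hB, mem_insert]
      by_cases hq : q = p
      · subst hq; simp only [mem_symmDiff]; tauto
      · tauto
    rw [this, card_insert_of_notMem]
    simp only [mem_symmDiff]; tauto
  · intro hp
    have : symmDiff A X = insert p (symmDiff B X) := by
      ext q
      rw [mem_insert, hB]
      by_cases hq : q = p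
      · subst hq; simp only [mem_symmDiff]; tauto
      · tauto
    rw [this, card_insert_of_notMem]
    rw [hB]; simp only [mem_symmDiff]; tauto

theorem IsDown.erase_maximal {Q A : Finset P} (h : IsDown Q A) {p : P}
    (hp : ∀ q ∈ A, p ≤ q → q = p) : IsDown Q (A.erase p) := by
  refine ⟨(erase_subset _ _).trans h.1, fun r hr q hq hqr => ?_⟩
  rw [mem_erase] at hr ⊢
  refine ⟨?_, h.2 r hr.2 q hq hqr⟩
  rintro rfl
  exact hr.1 (hp r hr.2 hqr)

theorem IsDown.insert_minimal {Q A : Finset P} (h : IsDown Q A) {p : P} (hpQ : p ∈ Q)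
    (hp : ∀ q ∈ Q, q ≤ p → q ≠ p → q ∈ A) : IsDown Q (insert p A) := by
  refine ⟨insert_subset hpQ h.1, fun r hr q hq hqr => ?_⟩
  rw [mem_insert] at hr ⊢
  rcases hr with rfl | hr
  · by_cases hqr' : q = r
    · exact Or.inl hqr'
    · exact Or.inr (hp q hq hqr hqr')
  · exact Or.inr (h.2 r hr q hq hqr)

theorem symmDiff_erase_self {A : Finset P} {p : P} (hp : p ∈ A) :
    symmDiff A (A.erase p) = {p} := by
  ext q
  simp only [mem_symmDiff, mem_erase, mem_singleton]
  by_cases h : q = p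
  · subst h; tauto
  · tauto

theorem symmDiff_insert_self {A : Finset P} {p : P} (hp : p ∉ A) :
    symmDiff A (insert p A) = {p} := by
  ext q
  simp only [mem_symmDiff, mem_insert, mem_singleton]
  by_cases h : q = p
  · subst h; tauto
  · tauto

/-- Two distinct down-sets: the first can be moved towards the second by one element. -/
theorem IsDown.exists_toggle {Q A B : Finset P} (hA : IsDown Q A) (hB : IsDown Q B)
    (hAB : A ≠ B) : ∃ C p, IsDown Q C ∧ symmDiff A C = {p} ∧ p ∈ symmDiff A B := by
  by_cases h : (A \ B).Nonempty
  · obtain ⟨p, hp, hmax⟩ := (A \ B).exists_maximal h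
    rw [mem_sdiff] at hp
    refine ⟨A.erase p, p, hA.erase_maximal fun q hq hpq => ?_, symmDiff_erase_self hp.1,
      mem_symmDiff.2 (Or.inl hp)⟩
    have hqB : q ∉ B := fun hqB => hp.2 (hB.2 q hqB p (hA.1 hp.1) hpq)
    exact le_antisymm (hmax (mem_sdiff.2 ⟨hq, hqB⟩) hpq) hpq
  · rw [not_nonempty_iff_eq_empty, sdiff_eq_empty_iff_subset] at h
    have h' : (B \ A).Nonempty := by
      rw [sdiff_nonempty]
      exact fun h' => hAB (h.antisymm h')
    obtain ⟨p, hp, hmin⟩ := (B \ A).exists_minimal h'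
    rw [mem_sdiff] at hp
    refine ⟨insert p A, p, hA.insert_minimal (hB.1 hp.1) fun q hq hqp hne => ?_,
      symmDiff_insert_self hp.2, mem_symmDiff.2 (Or.inr hp)⟩
    by_contra hqA
    exact hne (le_antisymm hqp (hmin (mem_sdiff.2 ⟨hB.2 p hp.1 q hq hqp, hqA⟩) hqp))

variable {Q : κ → Finset P}

theorem idx_eq_of_walk {x y : DownSet Q} (w : (downGraph Q).Walk x y) : x.idx = y.idx := by
  induction w with
  | nil => rfl
  | cons h _ ih => exact h.1.trans ih

theorem card_le_length {x y : DownSet Q} (w : (downGraph Q).Walk x y) :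
    (symmDiff x.set y.set).card ≤ w.length := by
  induction w with
  | nil => simp
  | @cons u v z h w ih =>
    have h' := h.2
    obtain ⟨p, hp⟩ := h'
    have := card_symmDiff_toggle (X := z.set) hp
    rw [SimpleGraph.Walk.length_cons]
    by_cases hh : p ∈ u.set ↔ p ∈ z.set
    · have := this.1 hh; omega
    · have := this.2 hh; omega

theorem exists_walk_length_eq (n : ℕ) : ∀ {x y : DownSet Q}, x.idx = y.idx →
    (symmDiff x.set y.set).card = n → ∃ w : (downGraph Q).Walk x y, w.length = n := by
  induction n with
  | zero =>
    intro x y h hn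
    rw [card_eq_zero] at hn
    obtain rfl : x = y := DownSet.ext' h (symmDiff_eq_bot.1 hn)
    exact ⟨.nil, rfl⟩
  | succ n ih =>
    intro x y h hn
    have hne : x.set ≠ y.set := by
      intro h'
      rw [h', symmDiff_self] at hn
      simp at hn
    obtain ⟨C, p, hC, hp, hpm⟩ := x.isDown.exists_toggle (h ▸ y.isDown) hne
    have hcard := (card_symmDiff_toggle (X := y.set) hp).2
      (by rw [mem_symmDiff] at hpm; tauto)
    obtain ⟨w, hw⟩ := ih (x := ⟨x.idx, C, hC⟩) (y := y) h
      (by change (symmDiff C y.set).card = n; omega)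
    exact ⟨.cons (show (downGraph Q).Adj x ⟨x.idx, C, hC⟩ from ⟨rfl, p, hp⟩) w, by simp [hw]⟩

theorem reachable_iff {x y : DownSet Q} : (downGraph Q).Reachable x y ↔ x.idx = y.idx :=
  ⟨fun ⟨w⟩ => idx_eq_of_walk w, fun h => (exists_walk_length_eq _ h rfl).elim fun w _ => ⟨w⟩⟩

/-- Each step of a walk toggles one element, and `IsDown.exists_toggle` always supplies a toggle
towards the target, so the Hamming bound is attained. -/
theorem dist_eq_of_idx_eq {x y : DownSet Q} (h : x.idx = y.idx) :
    (downGraph Q).dist x y = (symmDiff x.set y.set).card := by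
  apply le_antisymm
  · obtain ⟨w, hw⟩ := exists_walk_length_eq _ h rfl
    exact hw ▸ SimpleGraph.dist_le w
  · obtain ⟨w, hw⟩ := (reachable_iff.2 h).exists_walk_length_eq_dist
    exact hw ▸ card_le_length w

theorem dist_eq_of_idx_ne {x y : DownSet Q} (h : x.idx ≠ y.idx) : (downGraph Q).dist x y = 0 :=
  SimpleGraph.dist_eq_zero_of_not_reachable fun h' => h (reachable_iff.1 h')

theorem isDown_empty (Q : Finset P) : IsDown Q ∅ := ⟨empty_subset _, by simp⟩

theorem card_connectedComponent_downGraph (Q : κ → Finset P) :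
    Nat.card (downGraph Q).ConnectedComponent = Nat.card κ := by
  refine Nat.card_congr
    ⟨SimpleGraph.ConnectedComponent.lift DownSet.idx fun _ _ w _ => idx_eq_of_walk w,
      fun k => (downGraph Q).connectedComponentMk ⟨k, ∅, isDown_empty _⟩, ?_, fun _ => rfl⟩
  refine fun c => c.ind fun x => ?_
  exact SimpleGraph.ConnectedComponent.sound (reachable_iff.2 rfl)

theorem dist_iso_le {V W : Type*} {G : SimpleGraph V} {G' : SimpleGraph W} (e : G ≃g G') {x y : V}
    (h : G.Reachable x y) : G'.dist (e x) (e y) ≤ G.dist x y := by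
  obtain ⟨w, hw⟩ := h.exists_walk_length_eq_dist
  rw [← hw, ← SimpleGraph.Walk.length_map e.toHom w]
  exact SimpleGraph.dist_le _

theorem dist_iso {V W : Type*} {G : SimpleGraph V} {G' : SimpleGraph W} (e : G ≃g G') (x y : V) :
    G'.dist (e x) (e y) = G.dist x y := by
  by_cases h : G.Reachable x y
  · refine (dist_iso_le e h).antisymm ?_
    have := dist_iso_le e.symm (e.reachable_iff.2 h)
    rwa [RelIso.symm_apply_apply, RelIso.symm_apply_apply] at this
  · rw [SimpleGraph.dist_eq_zero_of_not_reachable h,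
      SimpleGraph.dist_eq_zero_of_not_reachable (fun h' => h (e.reachable_iff.1 h'))]

end DownSetGraph

/-! ### Theta-classes and the derivative of a union of down-set graphs -/

namespace DownSetGraph

open Finset CubeDerivative

variable {κ P : Type} [PartialOrder P] [DecidableEq P] [DecidableLE P] [DecidableLT P]
  {Q : κ → Finset P}

/-- The elements of `S` that are incomparable to `p`. -/
def incomparable (S : Finset P) (p : P) : Finset P := S.filter fun q => ¬ q ≤ p ∧ ¬ p ≤ q

theorem mem_incomparable {S : Finset P} {p q : P} :
    q ∈ incomparable S p ↔ q ∈ S ∧ ¬ q ≤ p ∧ ¬ p ≤ q := mem_filter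

/-- The ordered sets describing the derivative of `downGraph Q`. -/
def derivFamily (Q : κ → Finset P) (z : {z : κ × P // z.2 ∈ Q z.1}) : Finset P :=
  incomparable (Q z.1.1) z.1.2

section

variable {V : Type*} {G : SimpleGraph V} (e : G ≃g downGraph Q)

/-- The pair `(a, b)` is an edge of the `k`-th component that toggles the element `p`, where
`z = (k, p)`. -/
structure IsLabel (a b : V) (z : κ × P) : Prop where
  left : (e a).idx = z.1
  right : (e b).idx = z.1
  toggle : symmDiff (e a).set (e b).set = {z.2}

variable {e}

theorem IsLabel.symm {a b : V} {z : κ × P} (h : IsLabel e a b z) : IsLabel e b a z :=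
  ⟨h.right, h.left, by rw [symmDiff_comm]; exact h.toggle⟩

theorem IsLabel.unique {a b : V} {z z' : κ × P} (h : IsLabel e a b z) (h' : IsLabel e a b z') :
    z = z' :=
  Prod.ext (h.left.symm.trans h'.left) (singleton_injective (h.toggle.symm.trans h'.toggle))

theorem IsLabel.adj {a b : V} {z : κ × P} (h : IsLabel e a b z) : G.Adj a b :=
  e.map_adj_iff.1 ⟨h.left.trans h.right.symm, z.2, h.toggle⟩

theorem IsLabel.mem {a b : V} {z : κ × P} (h : IsLabel e a b z) : z.2 ∈ Q z.1 := by
  have hz : z.2 ∈ symmDiff (e a).set (e b).set := h.toggle ▸ mem_singleton_self _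
  rcases mem_symmDiff.1 hz with h' | h'
  · exact h.left ▸ (e a).isDown.1 h'.1
  · exact h.right ▸ (e b).isDown.1 h'.1

theorem exists_isLabel {a b : V} (h : G.Adj a b) : ∃ z, IsLabel e a b z := by
  obtain ⟨h1, p, hp⟩ := e.map_adj_iff.2 h
  exact ⟨((e a).idx, p), rfl, h1.symm, hp⟩

variable (e)

theorem exists_label (ε : G.edgeSet) : ∃ z : {z : κ × P // z.2 ∈ Q z.1},
    ∀ a b, ε.1 = s(a, b) → IsLabel e a b z := by
  obtain ⟨ε, hε⟩ := ε
  induction ε with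
  | _ a b =>
    obtain ⟨z, hz⟩ := exists_isLabel (e := e) (SimpleGraph.mem_edgeSet _ |>.1 hε)
    refine ⟨⟨z, hz.mem⟩, fun a' b' h => ?_⟩
    rcases Sym2.eq_iff.1 h with ⟨rfl, rfl⟩ | ⟨rfl, rfl⟩
    · exact hz
    · exact hz.symm

/-- The component and the element toggled by an edge. -/
noncomputable def label (ε : G.edgeSet) : {z : κ × P // z.2 ∈ Q z.1} :=
  (exists_label e ε).choose

theorem isLabel_label (ε : G.edgeSet) {a b : V} (h : ε.1 = s(a, b)) : IsLabel e a b (label e ε) :=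
  (exists_label e ε).choose_spec a b h

/-- If `xy` toggles an element other than the one toggled by `ab`, then `x` and `y` agree at the
latter, so passing from `a` to `b` changes both distances by the same amount. -/
theorem label_eq_of_theta {ε ε' : G.edgeSet} (h : Theta G ε ε') : label e ε = label e ε' := by
  obtain ⟨a, b, x, y, hε, hε', hd⟩ := h
  have hab := isLabel_label e ε hε
  have hxy := isLabel_label e ε' hε'
  simp only [← dist_iso e] at hd
  by_cases hk : (label e ε).1.1 = (label e ε').1.1
  · refine Subtype.ext (Prod.ext hk ?_)
    by_contra hp
    have e1 := hab.left.trans (hk.trans hxy.left.symm)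
    have e2 := hab.left.trans (hk.trans hxy.right.symm)
    have e3 := hab.right.trans (hk.trans hxy.left.symm)
    have e4 := hab.right.trans (hk.trans hxy.right.symm)
    rw [dist_eq_of_idx_eq e1, dist_eq_of_idx_eq e2, dist_eq_of_idx_eq e3,
      dist_eq_of_idx_eq e4] at hd
    have hx := card_symmDiff_toggle (X := (e x).set) hab.toggle
    have hy := card_symmDiff_toggle (X := (e y).set) hab.toggle
    have hm := (mem_iff_of_symmDiff_singleton hxy.toggle (label e ε).1.2).2 hp
    rw [hm] at hy
    by_cases hh : (label e ε).1.2 ∈ (e a).set ↔ (label e ε).1.2 ∈ (e x).set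
    · have := hx.1 hh; have := hy.1 hh; omega
    · have := hx.2 hh; have := hy.2 hh; omega
  -- In different components all four distances have the default value `0`.
  · have e1 : (e a).idx ≠ (e x).idx := by rw [hab.left, hxy.left]; exact hk
    have e2 : (e a).idx ≠ (e y).idx := by rw [hab.left, hxy.right]; exact hk
    have e3 : (e b).idx ≠ (e x).idx := by rw [hab.right, hxy.left]; exact hk
    have e4 : (e b).idx ≠ (e y).idx := by rw [hab.right, hxy.right]; exact hk
    simp [dist_eq_of_idx_ne e1, dist_eq_of_idx_ne e2, dist_eq_of_idx_ne e3,
      dist_eq_of_idx_ne e4] at hd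

/-- Here `x` and `y` disagree at the toggled element, so the distances to `x` and to `y` change by
one in opposite directions, and the two sums differ by two. -/
theorem theta_of_label_eq {ε ε' : G.edgeSet} (h : label e ε = label e ε') : Theta G ε ε' := by
  obtain ⟨a, b, hε⟩ : ∃ a b, ε.1 = s(a, b) := ε.1.ind (fun a b => ⟨a, b, rfl⟩)
  obtain ⟨x, y, hε'⟩ : ∃ a b, ε'.1 = s(a, b) := ε'.1.ind (fun a b => ⟨a, b, rfl⟩)
  have hab := isLabel_label e ε hε
  have hxy := isLabel_label e ε' hε'
  rw [← h] at hxy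
  refine ⟨a, b, x, y, hε, hε', ?_⟩
  simp only [← dist_iso e]
  rw [dist_eq_of_idx_eq (hab.left.trans hxy.left.symm),
    dist_eq_of_idx_eq (hab.left.trans hxy.right.symm),
    dist_eq_of_idx_eq (hab.right.trans hxy.left.symm),
    dist_eq_of_idx_eq (hab.right.trans hxy.right.symm)]
  have hx := card_symmDiff_toggle (X := (e x).set) hab.toggle
  have hy := card_symmDiff_toggle (X := (e y).set) hab.toggle
  have hm := mem_iff_of_symmDiff_singleton hxy.toggle (label e ε).1.2
  by_cases hh : (label e ε).1.2 ∈ (e a).set ↔ (label e ε).1.2 ∈ (e x).set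
  · have := hx.1 hh; have := hy.2 (by tauto); omega
  · have := hx.2 hh; have := hy.1 (by tauto); omega

/-- The label of a `Θ`-class. -/
noncomputable def classLabel : ThetaClass G → {z : κ × P // z.2 ∈ Q z.1} :=
  Quot.lift (label e) fun _ _ => label_eq_of_theta e

theorem classLabel_injective : Function.Injective (classLabel e) := by
  rintro ⟨ε⟩ ⟨ε'⟩ h
  exact Quot.sound (theta_of_label_eq e h)

theorem classLabel_surjective : Function.Surjective (classLabel e) := by
  rintro ⟨⟨k, p⟩, hp⟩
  -- Every `p` is toggled by some edge: the one joining the elements strictly below `p` to the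
  -- principal down-set of `p`.
  have hA : IsDown (Q k) ((Q k).filter (· < p)) :=
    ⟨filter_subset _ _, fun q hq r hr hrq =>
      mem_filter.2 ⟨hr, hrq.trans_lt (mem_filter.1 hq).2⟩⟩
  have hB : IsDown (Q k) (insert p ((Q k).filter (· < p))) :=
    hA.insert_minimal hp fun q hq hqp hne =>
      mem_filter.2 ⟨hq, lt_of_le_of_ne hqp hne⟩
  let x : DownSet Q := ⟨k, _, hA⟩
  let y : DownSet Q := ⟨k, _, hB⟩
  have hxy : IsLabel e (e.symm x) (e.symm y) (k, p) := by
    refine ⟨?_, ?_, ?_⟩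
    · rw [RelIso.apply_symm_apply]
    · rw [RelIso.apply_symm_apply]
    · rw [RelIso.apply_symm_apply, RelIso.apply_symm_apply]
      exact symmDiff_insert_self fun h => (mem_filter.1 h).2.false
  refine ⟨Quot.mk _ ⟨s(e.symm x, e.symm y), hxy.adj⟩, Subtype.ext ?_⟩
  exact (isLabel_label e _ rfl).unique hxy

theorem isLabel_rep (F : ThetaClass G) : IsLabel e F.rep.1 F.rep.2 (classLabel e F) := by
  have h : classLabel e F = label e (Quot.out F) := by
    conv_lhs => rw [← Quot.out_eq F]
    rfl
  rw [h]
  refine isLabel_label e _ ?_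
  exact (Quot.out_eq (Quot.out F).1).symm

variable {e}

theorem mem_W_iff {a b x : V} {z : κ × P} (h : IsLabel e a b z) :
    x ∈ W G a b ↔ (e x).idx = z.1 ∧ (z.2 ∈ (e a).set ↔ z.2 ∈ (e x).set) := by
  change G.dist x a < G.dist x b ↔ _
  rw [← dist_iso e, ← dist_iso e, SimpleGraph.dist_comm, SimpleGraph.dist_comm (u := e x)]
  by_cases hk : (e x).idx = z.1
  · rw [dist_eq_of_idx_eq (h.left.trans hk.symm), dist_eq_of_idx_eq (h.right.trans hk.symm)]
    have hx := card_symmDiff_toggle (X := (e x).set) h.toggle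
    by_cases hh : z.2 ∈ (e a).set ↔ z.2 ∈ (e x).set
    · have := hx.1 hh
      simp only [hk, hh, true_and, iff_true]; omega
    · have := hx.2 hh
      simp only [hh, and_false, iff_false]; omega
  -- In another component both distances default to `0`, so the strict inequality fails.
  · rw [dist_eq_of_idx_ne, dist_eq_of_idx_ne]
    · simp [hk]
    · rw [h.right]; exact Ne.symm hk
    · rw [h.left]; exact Ne.symm hk

theorem mem_U_iff {a b x : V} {z : κ × P} (h : IsLabel e a b z) :
    x ∈ U G a b ↔ (e x).idx = z.1 ∧ (z.2 ∈ (e a).set ↔ z.2 ∈ (e x).set) ∧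
      ∃ B, IsDown (Q z.1) B ∧ symmDiff (e x).set B = {z.2} := by
  change (x ∈ W G a b ∧ ∃ y ∈ W G b a, G.Adj x y) ↔ _
  rw [mem_W_iff h, and_assoc]
  refine and_congr_right fun hk => and_congr_right fun hp => ?_
  have hm := mem_iff_of_symmDiff_singleton h.toggle z.2
  constructor
  · rintro ⟨y, hy, hxy⟩
    rw [mem_W_iff h.symm] at hy
    obtain ⟨-, q, hq⟩ := e.map_adj_iff.2 hxy
    refine ⟨(e y).set, hy.1 ▸ (e y).isDown, ?_⟩
    have hm' := mem_iff_of_symmDiff_singleton hq z.2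
    obtain rfl : z.2 = q := by tauto
    exact hq
  · rintro ⟨B, hB, hxB⟩
    let y : DownSet Q := ⟨z.1, B, hB⟩
    refine ⟨e.symm y, (mem_W_iff h.symm).2 ?_, e.map_adj_iff.1 ?_⟩
    · rw [RelIso.apply_symm_apply]
      have hm' := mem_iff_of_symmDiff_singleton hxB z.2
      refine ⟨rfl, ?_⟩
      change _ ↔ z.2 ∈ B
      tauto
    · rw [RelIso.apply_symm_apply]
      exact ⟨hk, z.2, hxB⟩

end

/-- A down-set in which `p` can be toggled is determined, off the elements incomparable to `p`,
by whether it contains `p`. -/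
theorem mem_iff_of_toggle {S A B : Finset P} {p q : P} (hA : IsDown S A) (hB : IsDown S B)
    (h : symmDiff A B = {p}) (hp : p ∈ S) (hq : q ∈ S) (hqp : q ∉ incomparable S p) :
    q ∈ A ↔ q < p ∨ q = p ∧ p ∈ A := by
  have hm := mem_iff_of_symmDiff_singleton h
  rw [mem_incomparable] at hqp
  have hmp := hm p
  by_cases hqp' : q = p
  · subst hqp'; simp
  · have hmq := hm q
    simp only [hqp', false_and, or_false]
    constructor
    · intro hqA
      by_contra hlt
      have hpq : p ≤ q := by
        by_contra hpq
        exact hqp ⟨hq, fun h => hlt (lt_of_le_of_ne h hqp'), hpq⟩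
      have h1 := hA.2 q hqA p hp hpq
      have h2 := hB.2 q (by tauto) p hp hpq
      tauto
    · intro hlt
      by_cases hpA : p ∈ A
      · exact hA.2 p hpA q hq hlt.le
      · have := hB.2 p (by tauto) q hq hlt.le
        tauto

theorem isDown_inter_incomparable {S A : Finset P} (hA : IsDown S A) (p : P) :
    IsDown (incomparable S p) (A ∩ incomparable S p) := by
  refine ⟨inter_subset_right, fun q hq r hr hrq => ?_⟩
  rw [mem_inter] at hq ⊢
  exact ⟨hA.2 q hq.1 r (mem_incomparable.1 hr).1 hrq, hr⟩

theorem isDown_union_lt {S C : Finset P} {p : P} (hC : IsDown (incomparable S p) C) :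
    IsDown S (C ∪ S.filter (· < p)) := by
  refine ⟨union_subset (hC.1.trans (filter_subset _ _)) (filter_subset _ _),
    fun q hq r hr hrq => ?_⟩
  rw [mem_union, mem_filter] at hq ⊢
  rcases hq with hq | hq
  · have hqi := mem_incomparable.1 (hC.1 hq)
    by_cases hrp : r < p
    · exact Or.inr ⟨hr, hrp⟩
    · refine Or.inl (hC.2 q hq r (mem_incomparable.2
        ⟨hr, fun h => hrp (lt_of_le_of_ne h ?_), fun h => hqi.2.2 (h.trans hrq)⟩) hrq)
      rintro rfl
      exact hqi.2.2 hrq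
  · exact Or.inr ⟨hr, hrq.trans_lt hq.2⟩

section

variable {V : Type*} {G : SimpleGraph V} (e : G ≃g downGraph Q)

/-- A vertex of the derivative as a down-set of incomparable elements. -/
noncomputable def derivMap (v : DerivVertex G) : DownSet (derivFamily Q) where
  idx := classLabel e v.1.1
  set := (e v.1.2).set ∩ derivFamily Q (classLabel e v.1.1)
  isDown := by
    have h := ((mem_U_iff (isLabel_rep e v.1.1)).1 v.2).1
    have := isDown_inter_incomparable (h ▸ (e v.1.2).isDown) (classLabel e v.1.1).1.2
    exact this

/-- Off the incomparable elements a vertex of `U_{ab}` is forced: it contains what lies below `p`,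
nothing above `p`, and agrees with `a` at `p`. So intersecting with the incomparable elements loses
nothing. -/
theorem derivMap_mem_iff (v : DerivVertex G) {q : P}
    (hq : q ∉ derivFamily Q (classLabel e v.1.1)) :
    q ∈ (e v.1.2).set ↔ q ∈ Q (classLabel e v.1.1).1.1 ∧ (q < (classLabel e v.1.1).1.2 ∨
      q = (classLabel e v.1.1).1.2 ∧ (classLabel e v.1.1).1.2 ∈ (e v.1.1.rep.1).set) := by
  obtain ⟨h1, h2, B, hB, h3⟩ := (mem_U_iff (isLabel_rep e v.1.1)).1 v.2
  have hd : IsDown (Q (classLabel e v.1.1).1.1) (e v.1.2).set := h1 ▸ (e v.1.2).isDown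
  constructor
  · intro h
    have hqQ := hd.1 h
    rw [h2]
    exact ⟨hqQ, (mem_iff_of_toggle hd hB h3 (classLabel e v.1.1).2 hqQ hq).1 h⟩
  · rintro ⟨hqQ, h⟩
    rw [h2] at h
    exact (mem_iff_of_toggle hd hB h3 (classLabel e v.1.1).2 hqQ hq).2 h

theorem derivMap_injective : Function.Injective (derivMap e) := by
  rintro ⟨⟨F, x⟩, hx⟩ ⟨⟨F', x'⟩, hx'⟩ h
  have hF : F = F' := classLabel_injective e (congrArg DownSet.idx h)
  subst hF
  have hs : (e x).set ∩ derivFamily Q (classLabel e F) =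
    (e x').set ∩ derivFamily Q (classLabel e F) := congrArg DownSet.set h
  have h1 := ((mem_U_iff (isLabel_rep e F)).1 hx).1
  have h1' := ((mem_U_iff (isLabel_rep e F)).1 hx').1
  have : x = x' := by
    apply e.injective
    refine DownSet.ext' (h1.trans h1'.symm) ?_
    ext q
    by_cases hq : q ∈ derivFamily Q (classLabel e F)
    · have := Finset.ext_iff.1 hs q
      simpa only [mem_inter, hq, and_true] using this
    · exact (derivMap_mem_iff e ⟨⟨F, x⟩, hx⟩ hq).trans (derivMap_mem_iff e ⟨⟨F, x'⟩, hx'⟩ hq).symm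
  subst this
  rfl

theorem derivMap_surjective : Function.Surjective (derivMap e) := by
  rintro ⟨z, C, hC⟩
  obtain ⟨F, rfl⟩ := classLabel_surjective e z
  have hl := isLabel_rep e F
  set p := (classLabel e F).1.2 with hpdef
  set k := (classLabel e F).1.1 with hkdef
  have hpQ : p ∈ Q k := (classLabel e F).2
  have hA : IsDown (Q k) (C ∪ (Q k).filter (· < p)) := isDown_union_lt hC
  have hB : IsDown (Q k) (insert p (C ∪ (Q k).filter (· < p))) :=
    hA.insert_minimal hpQ fun q hq hqp hne =>
      mem_union_right _ (mem_filter.2 ⟨hq, lt_of_le_of_ne hqp hne⟩)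
  have hpC : p ∉ C := fun h => (mem_incomparable.1 (hC.1 h)).2.1 le_rfl
  have hpA : p ∉ C ∪ (Q k).filter (· < p) := by simp [hpC]
  have hAB := symmDiff_insert_self hpA
  have hCA : ∀ q ∈ derivFamily Q (classLabel e F), q ∈ C ∪ (Q k).filter (· < p) ↔ q ∈ C := by
    intro q hq
    rw [mem_union, mem_filter, or_iff_left]
    exact fun h => (mem_incomparable.1 hq).2.1 h.2.le
  have key : ∀ A B : Finset P, IsDown (Q k) A → IsDown (Q k) B → symmDiff A B = {p} →
      (p ∈ (e F.rep.1).set ↔ p ∈ A) → A ∩ derivFamily Q (classLabel e F) = C →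
      ∃ v, derivMap e v = ⟨classLabel e F, C, hC⟩ := by
    intro A B hA hB hAB hp hAC
    refine ⟨⟨⟨F, e.symm ⟨k, A, hA⟩⟩, (mem_U_iff hl).2 ?_⟩, DownSet.ext' rfl ?_⟩
    · rw [RelIso.apply_symm_apply]
      exact ⟨rfl, hp, B, hB, hAB⟩
    · change (e (e.symm ⟨k, A, hA⟩)).set ∩ derivFamily Q (classLabel e F) = C
      rw [RelIso.apply_symm_apply]
      exact hAC
  -- The preimage must lie on the same side of the `Θ`-class as the chosen end `F.rep.1`, which
  -- decides whether `p` is added.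
  by_cases hp : p ∈ (e F.rep.1).set
  · refine key _ _ hB hA (by rw [symmDiff_comm]; exact hAB) (by simp [hp]) ?_
    ext q
    rw [mem_inter, mem_insert]
    constructor
    · rintro ⟨rfl | h, hq⟩
      · exact absurd le_rfl (mem_incomparable.1 hq).2.1
      · exact (hCA q hq).1 h
    · exact fun h => ⟨Or.inr (mem_union_left _ h), hC.1 h⟩
  · refine key _ _ hA hB hAB (by simp only [hp, hpA]) ?_
    ext q
    rw [mem_inter]
    exact ⟨fun h => (hCA q h.2).1 h.1, fun h => ⟨mem_union_left _ h, hC.1 h⟩⟩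

theorem derivMap_adj (v w : DerivVertex G) :
    (downGraph (derivFamily Q)).Adj (derivMap e v) (derivMap e w) ↔ (deriv G).Adj v w := by
  change (classLabel e v.1.1 = classLabel e w.1.1 ∧ _) ↔ (v.1.1 = w.1.1 ∧ _)
  rw [(classLabel_injective e).eq_iff]
  refine and_congr_right fun hF => ?_
  rw [← e.map_adj_iff]
  have hv := ((mem_U_iff (isLabel_rep e v.1.1)).1 v.2).1
  have hw := ((mem_U_iff (isLabel_rep e w.1.1)).1 w.2).1
  have hs : symmDiff (derivMap e v).set (derivMap e w).set
      = symmDiff (e v.1.2).set (e w.1.2).set := by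
    ext q
    change q ∈ symmDiff ((e v.1.2).set ∩ derivFamily Q (classLabel e v.1.1))
      ((e w.1.2).set ∩ derivFamily Q (classLabel e w.1.1)) ↔ _
    have h1 := derivMap_mem_iff e v (q := q)
    have h2 := derivMap_mem_iff e w (q := q)
    rw [← hF] at h2 ⊢
    simp only [mem_symmDiff, mem_inter]
    by_cases hq : q ∈ derivFamily Q (classLabel e v.1.1)
    · simp only [hq, and_true]
    · have h3 := (h1 hq).trans (h2 hq).symm
      simp only [hq, h3, and_false, or_self, and_not_self_iff]
  constructor
  · rintro ⟨p, hp⟩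
    exact ⟨hv.trans (hF ▸ hw.symm), p, hs ▸ hp⟩
  · rintro ⟨-, p, hp⟩
    exact ⟨p, hs ▸ hp⟩

/-- The derivative of a disjoint union of cover graphs of lattices of down-sets. -/
noncomputable def derivIso : deriv G ≃g downGraph (derivFamily Q) where
  toEquiv := Equiv.ofBijective (derivMap e) ⟨derivMap_injective e, derivMap_surjective e⟩
  map_rel_iff' := derivMap_adj e _ _

end

end DownSetGraph

/-! ### Counting antichains through iterated derivatives -/

namespace DownSetGraph

open Finset CubeDerivative

section

variable {P : Type} [PartialOrder P]

/-- The antichains with `j` elements in `S`. -/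
noncomputable def antichains (S : Finset P) (j : ℕ) : Finset (Finset P) :=
  @Finset.filter _ (fun A : Finset P => IsAntichain (· ≤ ·) (A : Set P)) (Classical.decPred _)
    (S.powersetCard j)

theorem mem_antichains {S A : Finset P} {j : ℕ} :
    A ∈ antichains S j ↔ A ⊆ S ∧ A.card = j ∧ IsAntichain (· ≤ ·) (A : Set P) := by
  rw [antichains, @mem_filter _ _ (Classical.decPred _), mem_powersetCard, and_assoc]

theorem card_antichains_zero (S : Finset P) : (antichains S 0).card = 1 := by
  rw [card_eq_one]
  refine ⟨∅, ?_⟩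
  ext A
  rw [mem_antichains, mem_singleton, card_eq_zero]
  exact ⟨fun h => h.2.1, by rintro rfl; simp⟩

variable [DecidableEq P] [DecidableLE P] [DecidableLT P]

/-- Both sides count antichains of size `j + 1` with a distinguished element: removing `p` leaves an
antichain among the elements incomparable to `p`. -/
theorem sum_card_antichains_incomparable (S : Finset P) (j : ℕ) :
    ∑ p ∈ S, (antichains (incomparable S p) j).card = (j + 1) * (antichains S (j + 1)).card := by
  have h2 : ((antichains S (j + 1)).sigma fun A => A).card
      = (j + 1) * (antichains S (j + 1)).card := by
    rw [card_sigma, sum_const_nat (m := j + 1) fun A hA => (mem_antichains.1 hA).2.1, mul_comm]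
  rw [← card_sigma, ← h2]
  refine card_nbij' (fun x => ⟨insert x.1 x.2, x.1⟩) (fun y => ⟨y.2, y.1.erase y.2⟩) ?_ ?_ ?_ ?_
  · rintro ⟨p, B⟩ h
    simp only [coe_sigma, Set.mem_sigma_iff, mem_coe, mem_antichains] at h ⊢
    obtain ⟨hp, hB, hc, ha⟩ := h
    have hpB : p ∉ B := fun h => (mem_incomparable.1 (hB h)).2.1 le_rfl
    refine ⟨⟨insert_subset hp (hB.trans (filter_subset _ _)), by rw [card_insert_of_notMem hpB, hc],
      ?_⟩, mem_insert_self _ _⟩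
    rw [coe_insert]
    exact ha.insert (fun q hq _ => (mem_incomparable.1 (hB hq)).2.1)
      (fun q hq _ => (mem_incomparable.1 (hB hq)).2.2)
  · rintro ⟨A, p⟩ h
    simp only [coe_sigma, Set.mem_sigma_iff, mem_coe, mem_antichains] at h ⊢
    obtain ⟨⟨hA, hc, ha⟩, hp⟩ := h
    refine ⟨hA hp, fun q hq => ?_, by rw [card_erase_of_mem hp, hc]; rfl,
      ha.subset (by simp)⟩
    rw [mem_erase] at hq
    exact mem_incomparable.2 ⟨hA hq.2, ha hq.2 hp hq.1, ha hp hq.2 hq.1.symm⟩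
  · rintro ⟨p, B⟩ h
    simp only [coe_sigma, Set.mem_sigma_iff, mem_coe, mem_antichains] at h
    have hpB : p ∉ B := fun h' => (mem_incomparable.1 (h.2.1 h')).2.1 le_rfl
    simp [hpB]
  · rintro ⟨A, p⟩ h
    simp only [coe_sigma, Set.mem_sigma_iff, mem_coe] at h
    simp [h.2]

theorem sum_derivFamily {κ : Type} [Fintype κ] (Q : κ → Finset P) [Fintype P]
    (g : Finset P → ℕ) :
    ∑ z, g (derivFamily Q z) = ∑ k, ∑ p ∈ Q k, g (incomparable (Q k) p) := by
  have := Finset.sum_subtype (p := fun z : κ × P => z.2 ∈ Q z.1)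
    (univ.filter fun z : κ × P => z.2 ∈ Q z.1) (by simp)
    (F := inferInstance) (fun z => g (incomparable (Q z.1) z.2))
  refine Eq.trans ?_ (this.symm.trans ?_)
  · rfl
  · rw [sum_filter, Fintype.sum_prod_type]
    refine sum_congr rfl fun k _ => ?_
    rw [← sum_filter]
    congr 1
    ext; simp

/-- The count for all `j` at once makes the induction work: one more derivative trades a factor `j +
1` for a shift of the antichain size by one. -/
theorem exists_iterDeriv_iso [Fintype P] {V : Type} {G : SimpleGraph V}
    (e : G ≃g downGraph fun _ : Unit => (univ : Finset P)) (i : ℕ) :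
    ∃ (κ : Type) (_ : Fintype κ) (Q : κ → Finset P),
      Nonempty ((iterDeriv G i).2 ≃g downGraph Q) ∧
      ∀ j, j.factorial * ∑ k, (antichains (Q k) j).card
        = (i + j).factorial * (antichains (univ : Finset P) (i + j)).card := by
  induction i with
  | zero => exact ⟨Unit, inferInstance, _, ⟨e⟩, fun j => by simp⟩
  | succ i ih =>
    obtain ⟨κ, _, Q, ⟨f⟩, h⟩ := ih
    refine ⟨_, inferInstance, derivFamily Q, ⟨derivIso f⟩, fun j => ?_⟩
    rw [sum_derivFamily Q fun S => (antichains S j).card]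
    simp only [sum_card_antichains_incomparable]
    rw [← mul_sum, ← mul_assoc, mul_comm j.factorial, ← Nat.factorial_succ, h,
      add_assoc, add_comm 1 j]

/-- At `j = 0` every poset of the family contributes just the empty antichain, so the sum counts the
posets, one for each connected component. -/
theorem theta_eq_factorial_mul_card_antichains [Fintype P] {V : Type} {G : SimpleGraph V}
    (e : G ≃g downGraph fun _ : Unit => (univ : Finset P)) (i : ℕ) :
    theta G i = i.factorial * (antichains (univ : Finset P) i).card := by
  obtain ⟨κ, _, Q, ⟨f⟩, h⟩ := exists_iterDeriv_iso e i
  have h0 := h 0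
  simp only [card_antichains_zero, sum_const, card_univ, smul_eq_mul, mul_one, Nat.factorial_zero,
    one_mul, add_zero] at h0
  rw [theta, ← h0, ← Nat.card_eq_fintype_card, ← card_connectedComponent_downGraph Q]
  exact Nat.card_congr f.connectedComponentEquiv

end

/-! ### Lower sets, their covers and Birkhoff's representation -/

section

variable {P : Type} [PartialOrder P]

theorem lowerSet_covBy_iff [Finite P] {s t : LowerSet P} :
    s ⋖ t ↔ ∃ p ∉ s, (t : Set P) = insert p (s : Set P) := by
  constructor
  · intro h
    obtain ⟨p, hp, hmax⟩ := ((t : Set P) \ s).toFinite.exists_maximal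
      (Set.sdiff_nonempty.2 fun h' => h.lt.not_ge (LowerSet.coe_subset_coe.1 h'))
    refine ⟨p, hp.2, ?_⟩
    -- `LowerSet.erase` removes everything above `p`. Inside `t` this is `p` alone: an element of
    -- `t` above `p` is not in `s`, and `p` is maximal in `t \ s`.
    have herase : (t.erase p : Set P) = (t : Set P) \ {p} := by
      ext q
      simp only [LowerSet.coe_erase, Set.mem_sdiff, Set.mem_singleton_iff, SetLike.mem_coe,
        UpperSet.mem_Ici_iff]
      refine and_congr_right fun hq => not_congr ⟨fun hpq => ?_, fun hpq => hpq.ge⟩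
      exact le_antisymm (hmax ⟨hq, fun hqs => hp.2 (s.lower hpq hqs)⟩ hpq) hpq
    have hle : s ≤ t.erase p := by
      intro q hq
      have : q ∈ (t : Set P) \ {p} := ⟨h.le hq, by rintro rfl; exact hp.2 hq⟩
      rwa [← herase] at this
    rcases h.eq_or_eq hle LowerSet.erase_le with h' | h'
    · rw [← h', herase]
      simp [hp.1]
    · exact absurd hp.1 (LowerSet.erase_eq.1 h')
  · rintro ⟨p, hp, ht⟩
    have h : (s : Set P) ⋖ t := ht ▸ Set.covBy_insert hp
    exact ⟨LowerSet.coe_ssubset_coe.1 h.1, fun u h1 h2 =>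
      h.2 (LowerSet.coe_ssubset_coe.2 h1) (LowerSet.coe_ssubset_coe.2 h2)⟩

/-- A lower cover arises by deleting one element, and what remains is a lower set exactly when that
element is maximal. -/
theorem ncard_lower_covers [Finite P] (t : LowerSet P) :
    {s | s ⋖ t}.ncard = {p | Maximal (· ∈ t) p}.ncard := by
  symm
  refine Set.ncard_congr (fun p _ => t.erase p) ?_ ?_ ?_
  · intro p hp
    refine lowerSet_covBy_iff.2 ⟨p, fun h => h.2 (le_refl p), ?_⟩
    rw [LowerSet.coe_erase]
    ext q
    simp only [Set.mem_insert_iff, Set.mem_sdiff, SetLike.mem_coe, UpperSet.mem_Ici_iff]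
    constructor
    · intro hq
      by_cases hpq : p ≤ q
      · exact Or.inl (le_antisymm (hp.2 hq hpq) hpq)
      · exact Or.inr ⟨hq, hpq⟩
    · rintro (rfl | h)
      exacts [hp.1, h.1]
  · intro p q hp hq h
    have hpe : p ∉ t.erase q := by
      change t.erase p = t.erase q at h
      rw [← h]
      exact fun h => h.2 (le_refl p)
    have : q ≤ p := by
      by_contra hqp
      exact hpe (show p ∈ (t : Set P) \ UpperSet.Ici q from ⟨hp.1, hqp⟩)
    exact le_antisymm (hq.2 hp.1 this) this
  · intro s hs
    obtain ⟨p, hp, ht⟩ := lowerSet_covBy_iff.1 hs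
    have hpt : p ∈ t := by rw [← SetLike.mem_coe, ht]; exact Set.mem_insert _ _
    have hmax : ∀ q ∈ t, p ≤ q → q = p := by
      intro q hq hpq
      rw [← SetLike.mem_coe, ht] at hq
      rcases hq with rfl | hq
      · rfl
      · exact absurd (s.lower hpq hq) hp
    refine ⟨p, ⟨hpt, fun q hq hpq => (hmax q hq hpq).le⟩, SetLike.coe_injective ?_⟩
    ext q
    simp only [LowerSet.coe_erase, Set.mem_sdiff, SetLike.mem_coe, UpperSet.mem_Ici_iff]
    constructor
    · rintro ⟨hq, hpq⟩
      rw [← SetLike.mem_coe, ht] at hq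
      rcases hq with rfl | hq
      · exact absurd le_rfl hpq
      · exact hq
    · exact fun hq => ⟨hs.le hq, fun hpq => hp (s.lower hpq hq)⟩

/-- In a finite poset a lower set is the lower closure of its antichain of maximal elements. -/
theorem card_lowerSet_ncard_maximal [Fintype P] [DecidableEq P] (i : ℕ) :
    Nat.card {t : LowerSet P // {p | Maximal (· ∈ t) p}.ncard = i}
      = (antichains (univ : Finset P) i).card := by
  rw [← Fintype.card_coe, ← Nat.card_eq_fintype_card]
  refine Nat.card_congr ⟨fun t => ⟨{p | Maximal (· ∈ t.1) p}.toFinite.toFinset, ?_⟩,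
    fun A => ⟨lowerClosure (A.1 : Set P), ?_⟩, ?_, ?_⟩
  · refine mem_antichains.2 ⟨subset_univ _, ?_, ?_⟩
    · rw [← Set.ncard_eq_toFinset_card, t.2]
    · rw [Set.Finite.coe_toFinset]
      exact setOfPred_maximal_antichain _
  · have hA := mem_antichains.1 A.2
    have : {p | Maximal (· ∈ lowerClosure (A.1 : Set P)) p} = (A.1 : Set P) := by
      ext p
      exact hA.2.2.maximal_mem_lowerClosure_iff_mem
    rw [this, Set.ncard_coe_finset, hA.2.1]
  · rintro ⟨t, ht⟩
    refine Subtype.ext (LowerSet.ext (Set.ext fun p => ?_))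
    change p ∈ lowerClosure _ ↔ p ∈ t
    rw [mem_lowerClosure]
    constructor
    · rintro ⟨q, hq, hpq⟩
      rw [Set.Finite.coe_toFinset] at hq
      exact t.lower hpq hq.1
    · intro hp
      obtain ⟨q, hpq, hq⟩ := (t : Set P).toFinite.exists_le_maximal hp
      exact ⟨q, by rw [Set.Finite.coe_toFinset]; exact hq, hpq⟩
  · rintro ⟨A, hA⟩
    refine Subtype.ext (Finset.ext fun p => ?_)
    rw [Set.Finite.mem_toFinset]
    exact (mem_antichains.1 hA).2.2.maximal_mem_lowerClosure_iff_mem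

/-- The cover graph of the lattice of lower sets as a graph of down-sets. -/
noncomputable def lowerSetIso [Fintype P] [DecidableEq P] :
    SimpleGraph.hasse (LowerSet P) ≃g downGraph fun _ : Unit => (univ : Finset P) where
  toFun t := ⟨(), (t : Set P).toFinite.toFinset, subset_univ _, fun p hp q _ hqp => by
    rw [Set.Finite.mem_toFinset] at hp ⊢
    exact t.lower hqp hp⟩
  invFun x := ⟨x.set, fun p q hqp hp => x.isDown.2 p hp q (mem_univ _) hqp⟩
  left_inv t := LowerSet.ext (by simp)
  right_inv x := DownSet.ext' rfl (by ext; simp)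
  map_rel_iff' := by
    intro s t
    -- A symmetric difference has no orientation; recording which of the two sets contains `p`
    -- splits adjacency into the two cover relations.
    have key : ∀ s t : LowerSet P, (∃ p ∉ s, (t : Set P) = insert p (s : Set P)) ↔
        ∃ p, p ∉ s ∧ p ∈ t ∧
          symmDiff (s : Set P).toFinite.toFinset (t : Set P).toFinite.toFinset = {p} := by
      intro s t
      refine exists_congr fun p => and_congr_right fun hp => ?_
      constructor
      · intro ht
        refine ⟨by rw [← SetLike.mem_coe, ht]; exact Set.mem_insert _ _, ?_⟩
        have : (t : Set P).toFinite.toFinset = insert p (s : Set P).toFinite.toFinset := by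
          ext q
          simp only [Set.Finite.mem_toFinset, mem_insert]
          rw [ht]
          rfl
        rw [this]
        exact symmDiff_insert_self (by simpa using hp)
      · rintro ⟨hpt, h⟩
        ext q
        have hq := mem_iff_of_symmDiff_singleton h q
        simp only [Set.Finite.mem_toFinset, SetLike.mem_coe] at hq
        rw [Set.mem_insert_iff, SetLike.mem_coe, SetLike.mem_coe]
        by_cases hqp : q = p
        · subst hqp; tauto
        · tauto
    change ((() : Unit) = () ∧ ∃ p, symmDiff (s : Set P).toFinite.toFinset
      (t : Set P).toFinite.toFinset = {p}) ↔ s ⋖ t ∨ t ⋖ s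
    rw [lowerSet_covBy_iff, lowerSet_covBy_iff, key, key,
      symmDiff_comm (t : Set P).toFinite.toFinset,
      ← exists_or]
    simp only [true_and]
    refine exists_congr fun p => ⟨fun h => ?_, by tauto⟩
    have hp := mem_iff_of_symmDiff_singleton h p
    simp only [Set.Finite.mem_toFinset, SetLike.mem_coe] at hp
    tauto

end

/-- The number of components of the higher derivatives of the cover graph of a finite distributive
lattice, counted by the numbers of lower covers of the elements. -/
theorem theta_hasse {L V : Type} [DistribLattice L] [Finite L] [Nonempty L] {G : SimpleGraph V}
    (e : G ≃g SimpleGraph.hasse L) (i : ℕ) :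
    theta G i = i.factorial * Nat.card {x : L // {y | y ⋖ x}.ncard = i} := by
  classical
  have := Fintype.ofFinite L
  let _ : OrderBot L := Fintype.toOrderBot L
  let o : L ≃o LowerSet {a : L // SupIrred a} := OrderIso.lowerSetSupIrred
  have o' : SimpleGraph.hasse L ≃g SimpleGraph.hasse (LowerSet {a : L // SupIrred a}) :=
    ⟨o.toEquiv, by
      intro a b
      exact or_congr (apply_covBy_apply_iff o) (apply_covBy_apply_iff o)⟩
  rw [theta_eq_factorial_mul_card_antichains ((e.trans o').trans lowerSetIso),
    ← card_lowerSet_ncard_maximal]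
  congr 1
  refine Nat.card_congr (o.toEquiv.subtypeEquiv fun x => ?_).symm
  rw [← ncard_lower_covers]
  have : {s | s ⋖ o.toEquiv x} = o '' {y | y ⋖ x} := by
    ext s
    obtain ⟨y, rfl⟩ := o.surjective s
    change o y ⋖ o x ↔ o y ∈ o '' _
    rw [apply_covBy_apply_iff, o.injective.mem_set_image]
    rfl
  rw [this, Set.ncard_image_of_injective _ o.injective]

end DownSetGraph

/-! ## Coordinates for the bonds of the hexagonal lattice -/

namespace Benzenoid

/-- The vertex of even parity at the lower left corner of the face `f`. -/
def evenV (f : ℤ × ℤ) : ℤ × ℤ := (2 * f.1 + f.2, f.2)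

/-- The vertex of odd parity at the bottom of the face `f`. -/
def oddV (f : ℤ × ℤ) : ℤ × ℤ := (2 * f.1 + f.2 + 1, f.2)

/-- The displacement between the ends of a bond in direction `d`. -/
def off : Fin 3 → ℤ × ℤ := ![(0, 0), (-1, 0), (-1, 1)]

/-- The bond in direction `d` at the vertex `evenV f`. -/
def bond (d : Fin 3) (f : ℤ × ℤ) : Sym2 (ℤ × ℤ) := s(evenV f, oddV (f + off d))

/-- The face next to `bond d f` of which this bond is a side with even index. -/
def posFace (d : Fin 3) (f : ℤ × ℤ) : ℤ × ℤ := f + ![(0, 0), (0, -1), (-1, 0)] d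

/-- The face next to `bond d f` of which this bond is a side with odd index. -/
def negFace (d : Fin 3) (f : ℤ × ℤ) : ℤ × ℤ := f + ![(0, -1), (-1, 0), (0, 0)] d

theorem evenV_injective : Function.Injective evenV := by
  rintro ⟨a, b⟩ ⟨c, d⟩ h
  simp only [evenV, Prod.mk.injEq] at h ⊢
  omega

theorem oddV_injective : Function.Injective oddV := by
  rintro ⟨a, b⟩ ⟨c, d⟩ h
  simp only [oddV, Prod.mk.injEq] at h ⊢
  omega

theorem evenV_ne_oddV (f g : ℤ × ℤ) : evenV f ≠ oddV g := by
  intro h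
  simp only [evenV, oddV, Prod.mk.injEq] at h
  omega

theorem off_injective : Function.Injective off := by decide

theorem bond_inj {d d' : Fin 3} {f f' : ℤ × ℤ} : bond d f = bond d' f' ↔ d = d' ∧ f = f' := by
  constructor
  · intro h
    rcases Sym2.eq_iff.1 h with ⟨h1, h2⟩ | ⟨h1, _⟩
    · have hf := evenV_injective h1
      subst hf
      exact ⟨off_injective (add_left_cancel (oddV_injective h2)), rfl⟩
    · exact absurd h1 (evenV_ne_oddV _ _)
  · rintro ⟨rfl, rfl⟩
    rfl

theorem vertex_cases (v : ℤ × ℤ) : (∃ f, v = evenV f) ∨ ∃ f, v = oddV f := by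
  obtain ⟨x, y⟩ := v
  rcases Int.even_or_odd' (x - y) with ⟨k, hk | hk⟩
  · exact Or.inl ⟨(k, y), by ext <;> dsimp [evenV]; omega⟩
  · exact Or.inr ⟨(k, y), by ext <;> dsimp [oddV]; omega⟩

theorem adj_evenV_iff {f w : ℤ × ℤ} :
    hexLattice.Adj (evenV f) w ↔ ∃ d, w = oddV (f + off d) := by
  obtain ⟨a, b⟩ := f
  obtain ⟨x, y⟩ := w
  simp only [hexLattice, evenV, Fin.exists_fin_succ, off, oddV, Prod.mk.injEq, Int.even_iff]
  simp
  omega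

theorem adj_oddV_iff {f w : ℤ × ℤ} :
    hexLattice.Adj (oddV f) w ↔ ∃ d, w = evenV (f - off d) := by
  obtain ⟨a, b⟩ := f
  obtain ⟨x, y⟩ := w
  simp only [hexLattice, evenV, Fin.exists_fin_succ, off, oddV, Prod.mk.injEq, Int.even_iff]
  simp
  omega

theorem adj_iff_bond {u v : ℤ × ℤ} : hexLattice.Adj u v ↔ ∃ d f, s(u, v) = bond d f := by
  constructor
  · intro h
    rcases vertex_cases u with ⟨f, rfl⟩ | ⟨f, rfl⟩
    · obtain ⟨d, rfl⟩ := adj_evenV_iff.1 h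
      exact ⟨d, f, rfl⟩
    · obtain ⟨d, rfl⟩ := adj_oddV_iff.1 h
      refine ⟨d, f - off d, ?_⟩
      rw [bond, sub_add_cancel, Sym2.eq_swap]
  · rintro ⟨d, f, h⟩
    have hd : hexLattice.Adj (evenV f) (oddV (f + off d)) := adj_evenV_iff.2 ⟨d, rfl⟩
    rcases Sym2.eq_iff.1 h with ⟨rfl, rfl⟩ | ⟨rfl, rfl⟩
    exacts [hd, hd.symm]

theorem exists_bond {e : Sym2 (ℤ × ℤ)} (he : e ∈ hexLattice.edgeSet) : ∃ d f, e = bond d f := by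
  induction e with
  | _ u v => exact adj_iff_bond.1 he

theorem hexEdge_eq_bond (h : ℤ × ℤ) (j : Fin 6) :
    hexEdge h j = bond (![0, 1, 2, 0, 1, 2] j)
      (h + ![(0, 0), (1, 0), (1, 0), (0, 1), (0, 1), (0, 0)] j) := by
  obtain ⟨a, b⟩ := h
  fin_cases j <;>
    simp [hexEdge, hexVertex, bond, evenV, oddV, off] <;> omega

theorem bond_mem_hexEdges {d : Fin 3} {g h : ℤ × ℤ} :
    bond d g ∈ hexEdges h ↔ h = posFace d g ∨ h = negFace d g := by
  obtain ⟨a, b⟩ := g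
  obtain ⟨x, y⟩ := h
  simp only [hexEdges, Set.mem_range, hexEdge_eq_bond, bond_inj, Fin.exists_fin_succ, posFace,
    negFace]
  fin_cases d <;> simp <;> omega

theorem posFace_ne_negFace (d : Fin 3) (f : ℤ × ℤ) : posFace d f ≠ negFace d f := by
  obtain ⟨a, b⟩ := f
  fin_cases d <;> simp [posFace, negFace]

theorem mem_hexEdges_of_common {e : Sym2 (ℤ × ℤ)} {f g h : ℤ × ℤ} (hf : e ∈ hexEdges f)
    (hg : e ∈ hexEdges g) (hfg : f ≠ g) (hh : e ∈ hexEdges h) : h = f ∨ h = g := by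
  obtain ⟨d, k, rfl⟩ := exists_bond (hexEdges_subset f hf)
  rw [bond_mem_hexEdges] at hf hg hh
  rcases hf with rfl | rfl <;> rcases hg with rfl | rfl <;> rcases hh with rfl | rfl <;>
    simp_all

theorem evenV_mem_hexVertex (f : ℤ × ℤ) : evenV f ∈ Set.range (hexVertex f) := ⟨0, rfl⟩

theorem oddV_mem_hexVertex (f : ℤ × ℤ) : oddV f ∈ Set.range (hexVertex f) := ⟨1, rfl⟩

/-! ## Discrete potentials -/

theorem exists_partial_sum {u : ℤ → ℤ} {N : ℤ} (hu : ∀ k < N, u k = 0) :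
    ∃ s : ℤ → ℤ, (∀ k < N, s k = 0) ∧ ∀ k, s k - s (k - 1) = u k := by
  refine ⟨fun a => ∑ k ∈ Finset.Ico N (a + 1), u k, fun k hk => ?_, fun k => ?_⟩
  · dsimp only
    rw [Finset.Ico_eq_empty (by omega), Finset.sum_empty]
  · dsimp only
    by_cases hk : k < N
    · rw [hu k hk, Finset.Ico_eq_empty (by omega), Finset.Ico_eq_empty (by omega)]
      simp
    · rw [sub_add_cancel, ← Finset.insert_Ico_right_eq_Ico_add_one (by omega),
        Finset.sum_insert (by simp)]
      ring

theorem eq_of_step {s : ℤ → ℤ} (h : ∀ k, s k = s (k - 1)) (k l : ℤ) : s k = s l := by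
  have key : ∀ n : ℕ, ∀ k, s (k + n) = s k := by
    intro n
    induction n with
    | zero => simp
    | succ n ih =>
      intro k
      rw [h, ← ih k]
      congr 1
      push_cast
      ring
  rcases le_total k l with hkl | hkl
  · obtain ⟨n, rfl⟩ := Int.le.dest hkl
    exact (key n k).symm
  · obtain ⟨n, rfl⟩ := Int.le.dest hkl
    exact key n l

theorem finite_of_box {s : Set (ℤ × ℤ)} {N : ℤ}
    (h : ∀ f ∈ s, -N ≤ f.1 ∧ f.1 ≤ N ∧ -N ≤ f.2 ∧ f.2 ≤ N) : s.Finite :=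
  ((Set.finite_Icc (-N) N).prod (Set.finite_Icc (-N) N)).subset fun f hf =>
    have := h f hf; ⟨⟨this.1, this.2.1⟩, this.2.2⟩

theorem exists_box {s : Set (ℤ × ℤ)} (hs : s.Finite) :
    ∃ N : ℤ, 0 ≤ N ∧ ∀ f ∈ s, -N ≤ f.1 ∧ f.1 ≤ N ∧ -N ≤ f.2 ∧ f.2 ≤ N := by
  refine ⟨∑ f ∈ hs.toFinset, (|f.1| + |f.2|), by positivity, fun f hf => ?_⟩
  have := Finset.single_le_sum (f := fun f : ℤ × ℤ => |f.1| + |f.2|) (fun _ _ => by positivity)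
    (hs.mem_toFinset.2 hf)
  have h1 := abs_nonneg f.1
  have h2 := abs_nonneg f.2
  have h3 := neg_abs_le f.1
  have h4 := neg_abs_le f.2
  have h5 := le_abs_self f.1
  have h6 := le_abs_self f.2
  omega

theorem exists_box_support {m : Fin 3 → ℤ × ℤ → ℤ} (hm : ∀ d, (m d).support.Finite) :
    ∃ N : ℤ, 0 ≤ N ∧ ∀ d a b, (a < -N ∨ N < a ∨ b < -N ∨ N < b) → m d (a, b) = 0 := by
  obtain ⟨N, hN, h⟩ := exists_box (Set.finite_iUnion hm)
  refine ⟨N, hN, fun d a b hab => ?_⟩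
  by_contra hne
  have := h (a, b) (Set.mem_iUnion.2 ⟨d, hne⟩)
  dsimp only at this
  omega

/-- A function on the bonds that is closed at all vertices is the coboundary of a function on the
faces. -/
theorem exists_face_potential {m : Fin 3 → ℤ × ℤ → ℤ} (hm : ∀ d, (m d).support.Finite)
    (hE : ∀ f, ∑ d, m d f = 0) (hO : ∀ f, ∑ d, m d (f - off d) = 0) :
    ∃ φ : ℤ × ℤ → ℤ, φ.support.Finite ∧ ∀ d f, m d f = φ (posFace d f) - φ (negFace d f) := by
  obtain ⟨N, hN, hbox⟩ := exists_box_support hm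
  have hE' : ∀ a b, m 0 (a, b) + m 1 (a, b) + m 2 (a, b) = 0 := by
    intro a b; have := hE (a, b); rwa [Fin.sum_univ_three] at this
  have hO' : ∀ a b, m 0 (a, b) + m 1 (a + 1, b) + m 2 (a + 1, b - 1) = 0 := by
    intro a b; have := hO (a, b); rw [Fin.sum_univ_three] at this; simpa [off] using this
  -- The potential, up to sign, is obtained by summing along each row the bonds crossed by
  -- horizontal steps, starting left of the support.
  have hs : ∀ b, ∃ s : ℤ → ℤ, (∀ k < -N, s k = 0) ∧ ∀ k, s k - s (k - 1) = m 2 (k, b) :=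
    fun b => exists_partial_sum fun k hk => hbox 2 k b (Or.inl hk)
  choose s hs0 hs using hs
  -- The equation across the bonds of direction `0`: closedness at the vertices makes the left side
  -- constant along the row, and it vanishes far to the left.
  have hA : ∀ a b, m 0 (a, b) + s b a - s (b - 1) a = 0 := by
    intro a b
    have := eq_of_step (s := fun a => m 0 (a, b) + s b a - s (b - 1) a) (fun k => by
      have h1 := hs b k
      have h2 := hs (b - 1) k
      have h3 := hE' k b
      have h4 := hO' (k - 1) b
      rw [sub_add_cancel] at h4
      linarith) a (-N - 1)
    rw [this, hs0 _ _ (by omega), hs0 _ _ (by omega), hbox _ _ _ (by omega)]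
    rfl
  have hrow : ∀ a b, (b < -N ∨ N < b) → s b a = 0 := by
    intro a b hb
    rw [eq_of_step (s := s b) (fun k => by
      have := hs b k; rw [hbox 2 k b (by omega)] at this; omega)
      a (-N - 1), hs0 _ _ (by omega)]
  refine ⟨fun f => -s f.2 f.1, finite_of_box (N := N) ?_, ?_⟩
  · rintro ⟨a, b⟩ hf
    by_contra hout
    refine hf ?_
    change -s b a = 0
    rw [neg_eq_zero]
    dsimp only at hout
    by_cases hb : b < -N ∨ N < b
    · exact hrow a b hb
    · by_cases ha : a < -N
      · exact hs0 b a ha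
      -- To the right of the box `s` is constant along columns, so its value can be read off in a
      -- row above the box.
      · rw [eq_of_step (s := fun b => s b a) (fun k => by
          have := hA a k
          rw [hbox 0 a k (by omega)] at this
          omega) b (N + 1)]
        exact hrow a _ (by omega)
  · rintro d ⟨a, b⟩
    have h1 := hA a b
    have h2 := hs b a
    have h3 := hE' a b
    fin_cases d <;> simp [posFace, negFace, ← sub_eq_add_neg] <;> linarith

/-- A function on the bonds that is closed at all faces is the coboundary of a function on the
vertices. -/
theorem exists_vertex_potential {c : Fin 3 → ℤ × ℤ → ℤ} (hc : ∀ d, (c d).support.Finite)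
    (h : ∀ f : ℤ × ℤ, c 0 f + c 2 (f + (1, 0)) + c 1 (f + (0, 1))
      = c 1 (f + (1, 0)) + c 0 (f + (0, 1)) + c 2 f) :
    ∃ p q : ℤ × ℤ → ℤ, p.support.Finite ∧ q.support.Finite ∧
      ∀ d f, c d f = p f - q (f + off d) := by
  obtain ⟨N, hN, hbox⟩ := exists_box_support hc
  have h' : ∀ a b, c 0 (a, b) + c 2 (a + 1, b) + c 1 (a, b + 1)
      = c 1 (a + 1, b) + c 0 (a, b + 1) + c 2 (a, b) := by
    intro a b; simpa using h (a, b)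
  -- Direction `0` forces `q = p - c 0`; substituting this in direction `1` gives the increments of
  -- `p` along a row.
  have hs : ∀ b, ∃ s : ℤ → ℤ, (∀ k < -N, s k = 0) ∧
      ∀ k, s k - s (k - 1) = c 1 (k, b) - c 0 (k - 1, b) :=
    fun b => exists_partial_sum fun k hk => by
      rw [hbox 1 k b (Or.inl hk), hbox 0 (k - 1) b (by omega)]; rfl
  choose s hs0 hs using hs
  have hC : ∀ a b, c 2 (a, b) - s b a + s (b + 1) (a - 1) - c 0 (a - 1, b + 1) = 0 := by
    intro a b
    have := eq_of_step
      (s := fun a => c 2 (a, b) - s b a + s (b + 1) (a - 1) - c 0 (a - 1, b + 1)) (fun k => by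
      have h1 := hs b k
      have h2 := hs (b + 1) (k - 1)
      have h3 := h' (k - 1) b
      rw [sub_add_cancel] at h3
      linarith) a (-N - 1)
    rw [this, hs0 _ _ (by omega), hs0 _ _ (by omega), hbox _ _ _ (by omega), hbox _ _ _ (by omega)]
    rfl
  have hrow : ∀ a b, (b < -N ∨ N < b) → s b a = 0 := by
    intro a b hb
    rw [eq_of_step (s := s b) (fun k => by
      have := hs b k
      rw [hbox 1 k b (by omega), hbox 0 _ b (by omega)] at this; omega) a (-N - 1),
      hs0 _ _ (by omega)]
  have hsupp : ∀ a b, (a < -N ∨ N + 1 < a ∨ b < -N ∨ N < b) → s b a = 0 := by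
    intro a b hout
    by_cases hb : b < -N ∨ N < b
    · exact hrow a b hb
    · by_cases ha : a < -N
      · exact hs0 b a ha
      · rw [eq_of_step (s := fun b => s b a) (fun k => by
          have h1 := hC a (k - 1)
          have h2 := hs k a
          rw [hbox 2 a _ (by omega), hbox 0 _ _ (by omega), sub_add_cancel] at h1
          rw [hbox 1 _ _ (by omega), hbox 0 _ _ (by omega)] at h2
          omega) b (N + 1)]
        exact hrow a _ (by omega)
  refine ⟨fun f => s f.2 f.1, fun f => s f.2 f.1 - c 0 f, finite_of_box (N := N + 1) ?_,
    finite_of_box (N := N + 1) ?_, ?_⟩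
  · rintro ⟨a, b⟩ hf
    by_contra hout
    dsimp only at hout
    exact hf (hsupp a b (by omega))
  · rintro ⟨a, b⟩ hf
    by_contra hout
    dsimp only at hout
    refine hf ?_
    change s b a - c 0 (a, b) = 0
    rw [hsupp a b (by omega), hbox 0 a b (by omega)]
    rfl
  · rintro d ⟨a, b⟩
    have h1 := hC a b
    have h2 := hs b a
    fin_cases d <;> simp [off, ← sub_eq_add_neg] <;> linarith

end Benzenoid

namespace Benzenoid

/-! ## Cyclic flows through the faces -/

/-- A minimal nonempty invariant subset equals its image, since the image is invariant too; by
finiteness the map is then a bijection on it. -/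
theorem exists_bijOn_of_mapsTo {α : Type*} {T : α → α} {S : Set α} (hS : S.Finite)
    (hne : S.Nonempty) (hT : Set.MapsTo T S S) :
    ∃ Z ⊆ S, Z.Nonempty ∧ Set.BijOn T Z Z := by
  obtain ⟨Z, hZ⟩ := (hS.finite_subsets.subset
    (fun Z h => h.1 : {Z : Set α | Z ⊆ S ∧ Z.Nonempty ∧ Set.MapsTo T Z Z} ⊆ _)).exists_minimal
    ⟨S, subset_rfl, hne, hT⟩
  obtain ⟨hZS, hZne, hTZ⟩ := hZ.1
  have hsurj : Set.SurjOn T Z Z :=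
    hZ.2 ⟨hTZ.image_subset.trans hZS, hZne.image T, fun x hx =>
      Set.mem_image_of_mem T (hTZ.image_subset hx)⟩ hTZ.image_subset
  exact ⟨Z, hZS, hZne, ((hS.subset hZS).surjOn_iff_bijOn_of_mapsTo hTZ).1 hsurj⟩

theorem finite_support_comp_add {q : ℤ × ℤ → ℤ} (hq : q.support.Finite) (a : ℤ × ℤ) :
    (fun f => q (f + a)).support.Finite :=
  hq.preimage (add_left_injective a).injOn

/-- Summation by parts: pairing a coboundary with a weight `w` equals pairing the potentials with
the sums of `w` at the vertices. -/
theorem finsum_flow_mul {p q : ℤ × ℤ → ℤ} (hp : p.support.Finite) (hq : q.support.Finite)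
    (w : Fin 3 → ℤ × ℤ → ℤ) :
    ∑ᶠ f, ∑ d, (p f - q (f + off d)) * w d f
      = ∑ᶠ f, p f * ∑ d, w d f - ∑ᶠ f, q f * ∑ d, w d (f - off d) := by
  have h1 : ∀ d, (fun f => p f * w d f).support.Finite := fun d =>
    hp.subset (Function.support_mul_subset_left _ _)
  have h2 : ∀ d, (fun f => q (f + off d) * w d f).support.Finite := fun d =>
    (finite_support_comp_add hq (off d)).subset (Function.support_mul_subset_left _ _)
  have h3 : ∀ d, (fun f => q f * w d (f - off d)).support.Finite := fun d =>
    hq.subset (Function.support_mul_subset_left _ _)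
  have h4 : ∀ d, (fun f => (p f - q (f + off d)) * w d f).support.Finite := by
    intro d
    refine ((h1 d).union (h2 d)).subset ?_
    simp only [sub_mul]
    exact Function.support_sub _ _
  simp only [Finset.mul_sum]
  rw [finsum_sum_comm _ _ fun d _ => h4 d, finsum_sum_comm _ _ fun d _ => h1 d,
    finsum_sum_comm _ _ fun d _ => h3 d, ← Finset.sum_sub_distrib]
  refine Finset.sum_congr rfl fun d _ => ?_
  simp only [sub_mul]
  rw [finsum_sub_distrib (h1 d) (h2 d)]
  congr 1
  rw [← finsum_comp_equiv (Equiv.addRight (off d)) (f := fun f => q f * w d (f - off d))]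
  simp

/-- Finite subgraphs of the lattice whose bounded faces are all hexagons: a function of finite
support on the faces that is constant across the edges not in `H` vanishes at the faces not
in `H`. -/
structure HasNoHoles (H : hexLattice.Subgraph) : Prop where
  finite_verts : H.verts.Finite
  eq_zero : ∀ ν : ℤ × ℤ → ℤ, ν.support.Finite →
    (∀ f g e, ¬ hexagon f ≤ H → ¬ hexagon g ≤ H → e ∈ hexEdges f → e ∈ hexEdges g →
      e ∉ H.edgeSet → ν f = ν g) → ∀ f, ¬ hexagon f ≤ H → ν f = 0

variable {H : hexLattice.Subgraph}

theorem HasNoHoles.finite_faces (hH : HasNoHoles H) : {f | hexagon f ≤ H}.Finite := by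
  refine (hH.finite_verts.preimage evenV_injective.injOn).subset fun f hf => ?_
  exact hf.1 (evenV_mem_hexVertex f)

theorem mem_edgeSet_of_hexagon_le {h : ℤ × ℤ} (hh : hexagon h ≤ H) {e : Sym2 (ℤ × ℤ)}
    (he : e ∈ hexEdges h) : e ∈ H.edgeSet := by
  induction e with
  | _ u v => exact hh.2 he

/-- A flow between the faces of `H` whose potential is `p`, `q` vanishes outside `H`. -/
theorem HasNoHoles.potential_eq_zero (hH : HasNoHoles H) {c : Fin 3 → ℤ × ℤ → ℤ}
    (hc : ∀ d f, c d f ≠ 0 → hexagon (posFace d f) ≤ H ∧ hexagon (negFace d f) ≤ H)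
    {p q : ℤ × ℤ → ℤ} (hp : p.support.Finite) (hpq : ∀ d f, c d f = p f - q (f + off d)) :
    (∀ f, evenV f ∉ H.verts → p f = 0) ∧ ∀ f, oddV f ∉ H.verts → q f = 0 := by
  have hpos : ∀ d f, ¬ hexagon (posFace d f) ≤ H → p f = q (f + off d) := by
    intro d f hf
    have := hpq d f
    rw [not_not.1 (mt (hc d f) fun h => hf h.1)] at this
    omega
  have hneg : ∀ d f, ¬ hexagon (negFace d f) ≤ H → p f = q (f + off d) := by
    intro d f hf
    have := hpq d f
    rw [not_not.1 (mt (hc d f) fun h => hf h.2)] at this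
    omega
  have hface : ∀ f, ¬ hexagon f ≤ H → p f = q f ∧ p (f + (1, 0)) = p f ∧ p (f + (0, 1)) = p f := by
    rintro ⟨a, b⟩ hf
    have h0 := hpos 0 (a, b) (by simpa [posFace] using hf)
    have h1 := hneg 1 (a + 1, b) (by simpa [negFace] using hf)
    have h2 := hpos 2 (a + 1, b) (by simpa [posFace] using hf)
    have h3 := hneg 0 (a, b + 1) (by simpa [negFace] using hf)
    simp [off] at h0 h1 h2 h3
    simp only [Prod.mk_add_mk, add_zero]
    omega
  -- The function `p` is now read as a function on faces. The vertex `evenV k` is a corner of both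
  -- faces at `bond d k`, and `p` is constant on the even corners of a face outside `H`.
  have hk : ∀ d k, (¬ hexagon (posFace d k) ≤ H → p (posFace d k) = p k) ∧
      (¬ hexagon (negFace d k) ≤ H → p (negFace d k) = p k) := by
    rintro d ⟨a, b⟩
    have h1 := hface (a - 1, b)
    have h2 := hface (a, b - 1)
    simp only [Prod.mk_add_mk, add_zero, sub_add_cancel] at h1 h2
    fin_cases d <;> simp [posFace, negFace, ← sub_eq_add_neg] <;>
      first
      | exact ⟨fun h => (h1 h).2.1.symm, fun h => (h2 h).2.2.symm⟩
      | exact ⟨fun h => (h2 h).2.2.symm, fun h => (h1 h).2.1.symm⟩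
      | exact fun h => (h2 h).2.2.symm
      | exact fun h => (h1 h).2.1.symm
  have hzero := hH.eq_zero p hp (by
    intro f g e hf hg hef heg _
    obtain ⟨d, k, rfl⟩ := exists_bond (hexEdges_subset f hef)
    have key : ∀ f, ¬ hexagon f ≤ H → bond d k ∈ hexEdges f → p f = p k := by
      intro f hf hef
      rcases bond_mem_hexEdges.1 hef with rfl | rfl
      exacts [(hk d k).1 hf, (hk d k).2 hf]
    exact (key f hf hef).trans (key g hg heg).symm)
  refine ⟨fun f hf => hzero f fun h => hf (h.1 (evenV_mem_hexVertex f)), fun f hf => ?_⟩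
  have hf' : ¬ hexagon f ≤ H := fun h => hf (h.1 (oddV_mem_hexVertex f))
  rw [← (hface f hf').1, hzero f hf']

/-- The coordinates of the indicator function of a perfect matching of `H`. -/
structure IsMatchingFun (H : hexLattice.Subgraph) (m : Fin 3 → ℤ × ℤ → ℤ) : Prop where
  zero_or_one : ∀ d f, m d f = 0 ∨ m d f = 1
  mem : ∀ d f, m d f = 1 → bond d f ∈ H.edgeSet
  sum_even : ∀ f, evenV f ∈ H.verts → ∑ d, m d f = 1
  sum_odd : ∀ f, oddV f ∈ H.verts → ∑ d, m d (f - off d) = 1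

/-- The face next to `posFace d g` across `bond d g`, in terms of `posFace d g`. -/
theorem negFace_eq (d : Fin 3) (g : ℤ × ℤ) :
    negFace d g = posFace d g + ![(0, -1), (-1, 1), (1, 0)] d := by
  obtain ⟨a, b⟩ := g
  fin_cases d <;> simp [negFace, posFace]

/-- Think of `c` as a flow from `posFace` to `negFace` conserved at every face, so that `c` has
vertex potentials `p`, `q`, supported on `H`. Pairing with the matching gives `∑ p - ∑ q = 0`, as
the flow avoids matched bonds. Pairing with `1` gives three times the same quantity, so the
nonnegative `c` has total mass zero. -/
theorem no_cyclic_flow (hH : HasNoHoles H) {m : Fin 3 → ℤ × ℤ → ℤ} (hm : IsMatchingFun H m)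
    {c : Fin 3 → ℤ × ℤ → ℤ} (hc0 : ∀ d f, 0 ≤ c d f) (hfin : ∀ d, (c d).support.Finite)
    (hcons : ∀ f : ℤ × ℤ, c 0 f + c 2 (f + (1, 0)) + c 1 (f + (0, 1))
      = c 1 (f + (1, 0)) + c 0 (f + (0, 1)) + c 2 f)
    (hcH : ∀ d f, c d f ≠ 0 → hexagon (posFace d f) ≤ H ∧ hexagon (negFace d f) ≤ H)
    (hcm : ∀ d f, c d f ≠ 0 → m d f = 0) (d : Fin 3) (f : ℤ × ℤ) : c d f = 0 := by
  obtain ⟨p, q, hp, hq, hpq⟩ := exists_vertex_potential hfin hcons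
  obtain ⟨hp0, hq0⟩ := hH.potential_eq_zero hcH hp hpq
  have h1 := finsum_flow_mul hp hq m
  have h2 := finsum_flow_mul hp hq fun _ _ => 1
  simp only [← hpq] at h1 h2
  have hz : ∀ d f, c d f * m d f = 0 := by
    intro d f
    by_cases h : c d f = 0
    · rw [h, zero_mul]
    · rw [hcm d f h, mul_zero]
  have h3 : ∀ f, p f * ∑ d, m d f = p f := by
    intro f
    by_cases h : evenV f ∈ H.verts
    · rw [hm.sum_even f h, mul_one]
    · rw [hp0 f h, zero_mul]
  have h4 : ∀ f, q f * ∑ d, m d (f - off d) = q f := by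
    intro f
    by_cases h : oddV f ∈ H.verts
    · rw [hm.sum_odd f h, mul_one]
    · rw [hq0 f h, zero_mul]
  simp only [hz, h3, h4, Finset.sum_const_zero, finsum_zero] at h1
  simp only [mul_one, Finset.sum_const, Finset.card_univ, Fintype.card_fin] at h2
  rw [← finsum_mul, ← finsum_mul, ← sub_mul, ← h1, zero_mul] at h2
  have hnn : ∀ f, 0 ≤ ∑ d, c d f := fun f => Finset.sum_nonneg fun d _ => hc0 d f
  have hs : (fun f => ∑ d, c d f).support.Finite := by
    refine (Set.finite_iUnion hfin).subset fun f hf => ?_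
    obtain ⟨d, -, hd⟩ := Finset.exists_ne_zero_of_sum_ne_zero hf
    exact Set.mem_iUnion.2 ⟨d, hd⟩
  rw [finsum_eq_sum _ hs, Finset.sum_eq_zero_iff_of_nonneg fun f _ => hnn f] at h2
  have h5 : ∑ d, c d f = 0 := by
    by_contra h
    exact h (h2 f (hs.mem_toFinset.2 h))
  exact (Finset.sum_eq_zero_iff_of_nonneg fun d _ => hc0 d f).1 h5 d (Finset.mem_univ d)

/-- A set of faces of `H` whose boundary alternates with respect to a perfect matching contains an
alternating face. -/
theorem exists_alternating_face (hH : HasNoHoles H) {m : Fin 3 → ℤ × ℤ → ℤ}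
    (hm : IsMatchingFun H m) {S : Set (ℤ × ℤ)} (hS : S.Nonempty) (hSH : ∀ f ∈ S, hexagon f ≤ H)
    (hbd : ∀ d f, posFace d f ∈ S → negFace d f ∉ S → m d f = 1) :
    ∃ f ∈ S, ∀ d g, posFace d g = f → m d g = 1 := by
  classical
  by_contra! hcon
  have hex : ∀ f : ℤ × ℤ, ∃ d, f ∈ S → ∀ g, posFace d g = f → m d g ≠ 1 := by
    intro f
    by_cases hf : f ∈ S
    · obtain ⟨d, g, hg, hne⟩ := hcon f hf
      refine ⟨d, fun _ g' hg' => ?_⟩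
      obtain rfl : g' = g := add_right_cancel (hg'.trans hg.symm)
      exact hne
    · exact ⟨0, fun h => absurd h hf⟩
  choose D hD using hex
  let step : Fin 3 → ℤ × ℤ := ![(0, -1), (-1, 1), (1, 0)]
  let T : ℤ × ℤ → ℤ × ℤ := fun f => f + step (D f)
  -- Each face of `S` is left through an unmatched side of even index. Such a side cannot lie on the
  -- boundary of `S`, where `hbd` makes it matched.
  have hT : Set.MapsTo T S S := by
    intro f hf
    by_contra hTf
    let g := f - ![(0, 0), (0, -1), (-1, 0)] (D f)
    have hg : posFace (D f) g = f := sub_add_cancel _ _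
    refine hD f hf g hg (hbd _ _ (hg.symm ▸ hf) ?_)
    rw [negFace_eq, hg]
    exact hTf
  have hSfin : S.Finite := hH.finite_faces.subset hSH
  obtain ⟨Z, hZS, ⟨z, hz⟩, hZ⟩ := exists_bijOn_of_mapsTo hSfin hS hT
  -- One unit of flow leaves each face of the cyclic part `Z` through its chosen side; bijectivity
  -- of `T` on `Z` gives conservation.
  let c : Fin 3 → ℤ × ℤ → ℤ := fun d g =>
    if posFace d g ∈ Z ∧ D (posFace d g) = d then 1 else 0
  have hc : ∀ d g, c d g ≠ 0 → posFace d g ∈ Z ∧ D (posFace d g) = d := by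
    intro d g h
    by_contra h'
    exact h (if_neg h')
  have hzero := no_cyclic_flow hH hm (c := c) (fun d f => by positivity) ?_ ?_ ?_ ?_
  · have h := hzero (D z) (z - ![(0, 0), (0, -1), (-1, 0)] (D z))
    have hg : posFace (D z) (z - ![(0, 0), (0, -1), (-1, 0)] (D z)) = z := sub_add_cancel _ _
    simp [c, hg, hz] at h
  · intro d
    refine ((hSfin.subset hZS).preimage (f := posFace d) (add_left_injective _).injOn).subset ?_
    exact fun g hg => (hc d g hg).1
  · intro f
    have hout : c 0 f + c 2 (f + (1, 0)) + c 1 (f + (0, 1)) = if f ∈ Z then 1 else 0 := by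
      have e0 : posFace 0 f = f := by simp [posFace]
      have e1 : posFace 1 (f + (0, 1)) = f := by
        obtain ⟨a, b⟩ := f; simp [posFace]
      have e2 : posFace 2 (f + (1, 0)) = f := by
        obtain ⟨a, b⟩ := f; simp [posFace]
      simp only [c, e0, e1, e2]
      by_cases hf : f ∈ Z
      · generalize D f = d
        fin_cases d <;> simp [hf]
      · simp [hf]
    have hin : ∑ d, (if f - step d ∈ Z ∧ D (f - step d) = d then (1 : ℤ) else 0)
        = if f ∈ Z then 1 else 0 := by
      have hTd : ∀ d, D (f - step d) = d → T (f - step d) = f := by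
        intro d hd
        simp only [T, hd, sub_add_cancel]
      split_ifs with hf
      · obtain ⟨f', hf', hff⟩ := hZ.surjOn hf
        have hf'' : f - step (D f') = f' := by rw [← hff]; exact add_sub_cancel_right _ _
        rw [Finset.sum_eq_single (D f')]
        · rw [hf'', if_pos ⟨hf', rfl⟩]
        · intro d _ hd
          refine if_neg fun h => hd ?_
          rw [← h.2, hZ.injOn h.1 hf' ((hTd d h.2).trans hff.symm)]
        · simp
      · refine Finset.sum_eq_zero fun d _ => if_neg fun h => hf ?_
        rw [← hTd d h.2]
        exact hZ.mapsTo h.1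
    rw [hout, ← hin, Fin.sum_univ_three]
    have e0 : posFace 0 (f + (0, 1)) = f - step 0 := by
      obtain ⟨a, b⟩ := f; simp [posFace, step]
    have e1 : posFace 1 (f + (1, 0)) = f - step 1 := by
      obtain ⟨a, b⟩ := f; simp [posFace, step, ← sub_eq_add_neg]
    have e2 : posFace 2 f = f - step 2 := by
      obtain ⟨a, b⟩ := f; simp [posFace, step, ← sub_eq_add_neg]
    simp only [c, e0, e1, e2]
    ring
  · intro d g h
    obtain ⟨h1, h2⟩ := hc d g h
    refine ⟨hSH _ (hZS h1), hSH _ (hT (hZS h1) |> fun h => ?_)⟩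
    rw [negFace_eq]
    simpa only [T, h2] using h
  · intro d g h
    obtain ⟨h1, h2⟩ := hc d g h
    have h3 := hD _ (hZS h1) g (by rw [h2])
    rw [h2] at h3
    exact (hm.zero_or_one d g).resolve_right h3

end Benzenoid

namespace Benzenoid

/-! ## Hexagonal systems have no holes -/

theorem hexEdge_five_add (h : ℤ × ℤ) : hexEdge (h + (1, 0)) 5 = hexEdge h 2 := by
  rw [hexEdge_eq_bond, hexEdge_eq_bond, bond_inj]
  simp

theorem faceGraphOff_adj_right {C : Set (Sym2 (ℤ × ℤ))} {h : ℤ × ℤ} (hC : hexEdge h 2 ∉ C) :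
    (faceGraphOff C).Adj h (h + (1, 0)) := by
  refine ⟨by simp, hexEdge h 2, ⟨2, rfl⟩, ⟨5, hexEdge_five_add h⟩, hC⟩

theorem notMem_interiorFaces_of_injective {C : Set (Sym2 (ℤ × ℤ))} {u : ℕ → ℤ × ℤ}
    (hu : Function.Injective u) (hadj : ∀ n, (faceGraphOff C).Adj (u n) (u (n + 1))) :
    u 0 ∉ interiorFaces C := by
  intro hfin
  refine Set.infinite_of_injective_forall_mem hu (fun n => ?_) hfin
  change (faceGraphOff C).Reachable (u 0) (u n)
  induction n with
  | zero => rfl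
  | succ n ih => exact ih.trans (hadj n).reachable

theorem exists_right_mem_of_mem_interiorFaces {C : Set (Sym2 (ℤ × ℤ))} {h : ℤ × ℤ}
    (hh : h ∈ interiorFaces C) : ∃ n : ℕ, hexEdge (h + ((n : ℤ), 0)) 2 ∈ C := by
  by_contra! hcon
  refine notMem_interiorFaces_of_injective (C := C) (u := fun n : ℕ => h + ((n : ℤ), 0))
    (fun n k hnk => by simpa using hnk) (fun n => ?_) (by simpa [← Prod.zero_eq_mk] using hh)
  have := faceGraphOff_adj_right (hcon n)
  rw [add_assoc] at this
  simpa using this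

theorem exists_left_mem_of_mem_interiorFaces {C : Set (Sym2 (ℤ × ℤ))} {h : ℤ × ℤ}
    (hh : h ∈ interiorFaces C) : ∃ n : ℕ, hexEdge (h + (-(n : ℤ), 0)) 5 ∈ C := by
  by_contra! hcon
  refine notMem_interiorFaces_of_injective (C := C) (u := fun n : ℕ => h + (-(n : ℤ), 0))
    (fun n k hnk => by simpa using hnk) (fun n => ?_) (by simpa [← Prod.zero_eq_mk] using hh)
  have e : h + (-((n + 1 : ℕ) : ℤ), 0) + (1, 0) = h + (-(n : ℤ), 0) := by
    rw [add_assoc]; simp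
  have := faceGraphOff_adj_right (C := C) (h := h + (-((n + 1 : ℕ) : ℤ), 0)) (by
    rw [← hexEdge_five_add, e]; exact hcon n)
  rw [e] at this
  exact this.symm

/-- From an interior face both horizontal rays must meet the closed walk, which lies in a box. -/
theorem finite_interiorFaces {v : ℤ × ℤ} (c : hexLattice.Walk v v) :
    (interiorFaces {e | e ∈ c.edges}).Finite := by
  obtain ⟨N, -, hN⟩ := exists_box (List.finite_toSet c.support)
  refine finite_of_box (N := N) fun h hh => ?_
  obtain ⟨n, hn⟩ := exists_right_mem_of_mem_interiorFaces hh
  obtain ⟨k, hk⟩ := exists_left_mem_of_mem_interiorFaces hh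
  have h1 := hN _ (c.fst_mem_support_of_mem_edges hn)
  have h2 := hN _ (c.snd_mem_support_of_mem_edges hk)
  obtain ⟨a, b⟩ := h
  simp [hexVertex] at h1 h2
  dsimp only
  omega

theorem mem_edgeSet_system {v : ℤ × ℤ} (c : hexLattice.Walk v v) (e : Sym2 (ℤ × ℤ)) :
    e ∈ (c.toSubgraph ⊔ ⨆ h ∈ interiorFaces {e | e ∈ c.edges}, hexagon h).edgeSet ↔
      e ∈ c.edges ∨ ∃ h ∈ interiorFaces {e | e ∈ c.edges}, e ∈ hexEdges h := by
  induction e with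
  | _ x y =>
    rw [SimpleGraph.Subgraph.mem_edgeSet, SimpleGraph.Subgraph.sup_adj,
      ← SimpleGraph.Subgraph.mem_edgeSet, SimpleGraph.Walk.mem_edges_toSubgraph]
    simp only [SimpleGraph.Subgraph.iSup_adj, exists_prop]
    rfl

theorem mem_interiorFaces_of_reachable {C : Set (Sym2 (ℤ × ℤ))} {f g : ℤ × ℤ}
    (h : (faceGraphOff C).Reachable f g) (hg : g ∈ interiorFaces C) : f ∈ interiorFaces C :=
  Set.Finite.subset hg fun _ hk => h.symm.trans hk

/-- The hexagons of `H` are exactly the interior faces. Any other face reaches infinitely many faces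
without crossing the cycle, through edges not in `H`, so a function constant across these edges and
of finite support vanishes there. -/
theorem IsHexagonalSystem.hasNoHoles {H : hexLattice.Subgraph} (hH : IsHexagonalSystem H) :
    HasNoHoles H := by
  obtain ⟨v, c, -, rfl⟩ := hH
  have hcommon : ∀ f g e, f ∉ interiorFaces {e | e ∈ c.edges} →
      g ∉ interiorFaces {e | e ∈ c.edges} → f ≠ g → e ∈ hexEdges f → e ∈ hexEdges g →
      e ∉ c.edges →
      e ∉ (c.toSubgraph ⊔ ⨆ h ∈ interiorFaces {e | e ∈ c.edges}, hexagon h).edgeSet := by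
    intro f g e hf hg hne hef heg hec he
    rcases (mem_edgeSet_system c e).1 he with he | ⟨h, hh, he⟩
    · exact hec he
    · rcases mem_hexEdges_of_common hef heg hne he with rfl | rfl
      exacts [hf hh, hg hh]
  have hle : ∀ f, hexagon f ≤ (c.toSubgraph ⊔ ⨆ h ∈ interiorFaces {e | e ∈ c.edges}, hexagon h) ↔
      f ∈ interiorFaces {e | e ∈ c.edges} := by
    intro f
    constructor
    · intro h
      by_contra hf
      -- A second reachable face provides a first step out of `f`. The edge crossed lies between two
      -- exterior faces and off the cycle, hence is a side of `f` that is not in `H`.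
      obtain ⟨k, hk, hkf⟩ := (show Set.Infinite _ from hf).exists_notMem_finite
        (Set.finite_singleton f)
      obtain ⟨w⟩ : (faceGraphOff {e | e ∈ c.edges}).Reachable f k := hk
      cases w with
      | nil => exact hkf rfl
      | cons hadj w =>
        obtain ⟨hne, e, he1, he2, he3⟩ := hadj
        refine hcommon _ _ e hf (fun hg => hf ?_) hne he1 he2 he3
          (mem_edgeSet_of_hexagon_le h he1)
        exact mem_interiorFaces_of_reachable
          (SimpleGraph.Adj.reachable ⟨hne, e, he1, he2, he3⟩) hg
    · intro hf
      exact (le_iSup₂ (f := fun h _ => hexagon h) f hf).trans le_sup_right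
  refine ⟨?_, fun ν hν hc f hf => ?_⟩
  · rw [SimpleGraph.Subgraph.verts_sup]
    refine Set.Finite.union ?_ ?_
    · rw [SimpleGraph.Walk.verts_toSubgraph]
      exact List.finite_toSet c.support
    · simp only [SimpleGraph.Subgraph.verts_iSup]
      exact (finite_interiorFaces c).biUnion fun h _ => Set.finite_range (hexVertex h)
  · by_contra hne
    rw [hle] at hf
    refine hf (hν.subset fun k hk => ?_)
    obtain ⟨w⟩ : (faceGraphOff {e | e ∈ c.edges}).Reachable f k := hk
    have key : ∀ {f k} (w : (faceGraphOff {e | e ∈ c.edges}).Walk f k),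
        f ∉ interiorFaces {e | e ∈ c.edges} → ν f = ν k := by
      intro f k w
      induction w with
      | nil => exact fun _ => rfl
      | cons hadj w ih =>
        intro hf
        have hg := fun hg => hf (mem_interiorFaces_of_reachable hadj.reachable hg)
        obtain ⟨hne, e, he1, he2, he3⟩ := hadj
        rw [← ih hg]
        exact hc _ _ e (mt (hle _).1 hf) (mt (hle _).1 hg) he1 he2
          (hcommon _ _ e hf hg hne he1 he2 he3)
    change ν k ≠ 0
    rwa [← key w hf]

end Benzenoid

namespace Benzenoid

/-! ## Perfect matchings as functions on the bonds -/

variable {H : hexLattice.Subgraph}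

open scoped Classical in
/-- The indicator function of the edge set of `M`. -/
noncomputable def bondInd (M : hexLattice.Subgraph) (d : Fin 3) (f : ℤ × ℤ) : ℤ :=
  if bond d f ∈ M.edgeSet then 1 else 0

theorem bondInd_eq_one {M : hexLattice.Subgraph} {d : Fin 3} {f : ℤ × ℤ} :
    bondInd M d f = 1 ↔ bond d f ∈ M.edgeSet := by
  rw [bondInd]; split_ifs with h <;> simp [h]

theorem sum_eq_one_iff {x : Fin 3 → ℤ} (hx : ∀ d, x d = 0 ∨ x d = 1) :
    ∑ d, x d = 1 ↔ ∃! d, x d = 1 := by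
  rw [Fin.sum_univ_three]
  have h0 := hx 0
  have h1 := hx 1
  have h2 := hx 2
  constructor
  · intro h
    rcases h0 with h0 | h0
    · rcases h1 with h1 | h1
      · refine ⟨2, by omega, fun d hd => ?_⟩
        fin_cases d <;> simp_all
      · refine ⟨1, by omega, fun d hd => ?_⟩
        fin_cases d <;> simp_all
    · refine ⟨0, by omega, fun d hd => ?_⟩
      fin_cases d
      · rfl
      · change x 1 = 1 at hd; omega
      · change x 2 = 1 at hd; omega
  · rintro ⟨d, hd, huniq⟩
    have hu : ∀ d', d' ≠ d → x d' = 0 := fun d' h => (hx d').resolve_right fun h' => h (huniq d' h')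
    fin_cases d
    · have := hu 1 (by decide); have := hu 2 (by decide); simp_all
    · have := hu 0 (by decide); have := hu 2 (by decide); simp_all
    · have := hu 0 (by decide); have := hu 1 (by decide); simp_all

theorem isMatchingFun_bondInd (M : PerfectMatching H) : IsMatchingFun H (bondInd M.1) := by
  obtain ⟨M, hMH, hv, hM⟩ := M
  have h01 : ∀ d f, bondInd M d f = 0 ∨ bondInd M d f = 1 := by
    intro d f; rw [bondInd]; split_ifs <;> simp
  refine ⟨h01, fun d f h => SimpleGraph.Subgraph.edgeSet_mono hMH (bondInd_eq_one.1 h),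
    fun f hf => ?_, fun f hf => ?_⟩
  · obtain ⟨w, hw, huniq⟩ := hM (hv ▸ hf)
    obtain ⟨d, rfl⟩ := adj_evenV_iff.1 hw.adj_sub
    refine (sum_eq_one_iff fun d => h01 d f).2 ⟨d, bondInd_eq_one.2 hw, fun d' hd' => ?_⟩
    exact off_injective (add_left_cancel (oddV_injective (huniq _ (bondInd_eq_one.1 hd'))))
  · obtain ⟨w, hw, huniq⟩ := hM (hv ▸ hf)
    obtain ⟨d, rfl⟩ := adj_oddV_iff.1 hw.adj_sub
    have key : ∀ d, bondInd M d (f - off d) = 1 ↔ M.Adj (oddV f) (evenV (f - off d)) := by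
      intro d
      rw [bondInd_eq_one, bond, sub_add_cancel, Sym2.eq_swap]
      rfl
    refine (sum_eq_one_iff fun d => h01 d _).2 ⟨d, (key d).2 hw, fun d' hd' => ?_⟩
    exact off_injective (sub_right_injective (evenV_injective (huniq _ ((key d').1 hd'))))

/-- The perfect matching with a given indicator function. -/
def IsMatchingFun.toMatching {m : Fin 3 → ℤ × ℤ → ℤ} (hm : IsMatchingFun H m) :
    PerfectMatching H where
  val :=
    { verts := H.verts
      Adj := fun u v => ∃ d f, m d f = 1 ∧ s(u, v) = bond d f
      adj_sub := fun ⟨d, f, _, h⟩ => adj_iff_bond.2 ⟨d, f, h⟩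
      edge_vert := fun {u v} ⟨d, f, h1, h⟩ => by
        have := hm.mem d f h1
        rw [← h] at this
        exact H.edge_vert this
      symm := ⟨fun _ _ ⟨d, f, h1, h⟩ => ⟨d, f, h1, by rw [Sym2.eq_swap, h]⟩⟩ }
  property := by
    refine ⟨⟨subset_rfl, fun u v ⟨d, f, h1, h⟩ => ?_⟩, rfl, fun v hv => ?_⟩
    · have := hm.mem d f h1
      rwa [← h] at this
    · rcases vertex_cases v with ⟨f, rfl⟩ | ⟨f, rfl⟩
      · obtain ⟨d, hd, huniq⟩ :=
          (sum_eq_one_iff fun d => hm.zero_or_one d f).1 (hm.sum_even f hv)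
        refine ⟨oddV (f + off d), ⟨d, f, hd, rfl⟩, ?_⟩
        rintro w ⟨d', f', hd', h⟩
        rcases Sym2.eq_iff.1 h with ⟨h1, rfl⟩ | ⟨h1, _⟩
        · obtain rfl := evenV_injective h1
          rw [huniq d' hd']
        · exact absurd h1 (evenV_ne_oddV _ _)
      · obtain ⟨d, hd, huniq⟩ :=
          (sum_eq_one_iff fun d => hm.zero_or_one d (f - off d)).1 (hm.sum_odd f hv)
        refine ⟨evenV (f - off d), ⟨d, _, hd, by rw [bond, sub_add_cancel, Sym2.eq_swap]⟩, ?_⟩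
        rintro w ⟨d', f', hd', h⟩
        rcases Sym2.eq_iff.1 h with ⟨h1, _⟩ | ⟨h1, rfl⟩
        · exact absurd h1.symm (evenV_ne_oddV _ _)
        · obtain rfl := oddV_injective h1
          rw [← huniq d' (by dsimp only; rwa [add_sub_cancel_right]), add_sub_cancel_right]

theorem IsMatchingFun.bond_mem_toMatching {m : Fin 3 → ℤ × ℤ → ℤ} (hm : IsMatchingFun H m)
    {d : Fin 3} {f : ℤ × ℤ} : bond d f ∈ hm.toMatching.1.edgeSet ↔ m d f = 1 := by
  constructor
  · rintro ⟨d', f', h1, h⟩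
    obtain ⟨rfl, rfl⟩ := bond_inj.1 h
    exact h1
  · exact fun h => ⟨d, f, h, rfl⟩

theorem PerfectMatching.ext_bond {M N : PerfectMatching H}
    (h : ∀ d f, bond d f ∈ M.1.edgeSet ↔ bond d f ∈ N.1.edgeSet) : M = N := by
  refine Subtype.ext (SimpleGraph.Subgraph.ext (M.2.2.1.trans N.2.2.1.symm) ?_)
  have key : ∀ {M N : PerfectMatching H},
      (∀ d f, bond d f ∈ M.1.edgeSet ↔ bond d f ∈ N.1.edgeSet) → ∀ u v, M.1.Adj u v →
      N.1.Adj u v := by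
    intro M N h u v huv
    obtain ⟨d, f, hdf⟩ := adj_iff_bond.1 huv.adj_sub
    have hM : s(u, v) ∈ M.1.edgeSet := huv
    rw [hdf, h, ← hdf] at hM
    exact hM
  ext u v
  exact ⟨key h u v, key (fun d f => (h d f).symm) u v⟩

theorem HasNoHoles.finite_perfectMatching (hH : HasNoHoles H) : Finite (PerfectMatching H) := by
  have hfin : H.edgeSet.Finite := by
    refine ((hH.finite_verts.prod hH.finite_verts).image (fun p => s(p.1, p.2))).subset ?_
    intro e he
    induction e with
    | _ u v => exact ⟨(u, v), ⟨H.edge_vert he, H.edge_vert he.symm⟩, rfl⟩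
  have := hfin.finite_subsets.to_subtype
  refine Finite.of_injective (β := ↥{s | s ⊆ H.edgeSet})
    (fun M => ⟨M.1.edgeSet, SimpleGraph.Subgraph.edgeSet_mono M.2.1⟩) fun M N h => ?_
  have h' : M.1.edgeSet = N.1.edgeSet := congrArg Subtype.val h
  exact PerfectMatching.ext_bond fun d f => by rw [h']

/-! ## The lattice of height functions -/

/-- The function on the bonds with height function `φ` with respect to `m`. -/
def shift (m : Fin 3 → ℤ × ℤ → ℤ) (φ : ℤ × ℤ → ℤ) (d : Fin 3) (f : ℤ × ℤ) : ℤ :=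
  m d f + φ (posFace d f) - φ (negFace d f)

/-- The height functions of the perfect matchings of `H` with respect to the one given by `m`. -/
def heightLattice (H : hexLattice.Subgraph) (m : Fin 3 → ℤ × ℤ → ℤ) :
    Sublattice (ℤ × ℤ → ℤ) where
  carrier := {φ | (∀ f, ¬ hexagon f ≤ H → φ f = 0) ∧
    ∀ d f, 0 ≤ shift m φ d f ∧ shift m φ d f ≤ 1}
  -- A difference of two pointwise maxima lies between the two separate differences, so the bounds
  -- `0` and `1` persist; likewise for minima.
  supClosed' := by
    rintro φ ⟨h1, h2⟩ ψ ⟨h3, h4⟩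
    refine ⟨fun f hf => by simp [h1 f hf, h3 f hf], fun d f => ?_⟩
    have := h2 d f
    have := h4 d f
    simp only [shift, Pi.sup_apply] at *
    omega
  infClosed' := by
    rintro φ ⟨h1, h2⟩ ψ ⟨h3, h4⟩
    refine ⟨fun f hf => by simp [h1 f hf, h3 f hf], fun d f => ?_⟩
    have := h2 d f
    have := h4 d f
    simp only [shift, Pi.inf_apply] at *
    omega

variable {m : Fin 3 → ℤ × ℤ → ℤ}

theorem hexagon_not_le_of_bond_notMem {d : Fin 3} {f : ℤ × ℤ} (h : bond d f ∉ H.edgeSet) :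
    ¬ hexagon (posFace d f) ≤ H ∧ ¬ hexagon (negFace d f) ≤ H :=
  ⟨fun h' => h (mem_edgeSet_of_hexagon_le h' (bond_mem_hexEdges.2 (Or.inl rfl))),
    fun h' => h (mem_edgeSet_of_hexagon_le h' (bond_mem_hexEdges.2 (Or.inr rfl)))⟩

theorem sum_coboundary_even (φ : ℤ × ℤ → ℤ) (f : ℤ × ℤ) :
    ∑ d, (φ (posFace d f) - φ (negFace d f)) = 0 := by
  rw [Fin.sum_univ_three]
  simp [posFace, negFace]

theorem sum_coboundary_odd (φ : ℤ × ℤ → ℤ) (f : ℤ × ℤ) :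
    ∑ d, (φ (posFace d (f - off d)) - φ (negFace d (f - off d))) = 0 := by
  obtain ⟨a, b⟩ := f
  rw [Fin.sum_univ_three]
  simp [posFace, negFace, off, ← sub_eq_add_neg]

theorem isMatchingFun_shift (hm : IsMatchingFun H m) {φ : ℤ × ℤ → ℤ}
    (hφ : φ ∈ heightLattice H m) : IsMatchingFun H (shift m φ) := by
  obtain ⟨h0, h1⟩ := hφ
  refine ⟨fun d f => by have := h1 d f; omega, fun d f h => ?_, fun f hf => ?_, fun f hf => ?_⟩
  · by_contra hb
    have := hexagon_not_le_of_bond_notMem hb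
    rw [shift, h0 _ this.1, h0 _ this.2, add_zero, sub_zero] at h
    exact hb (hm.mem d f h)
  · simp only [shift, add_sub_assoc]
    rw [Finset.sum_add_distrib, sum_coboundary_even, hm.sum_even f hf, add_zero]
  · simp only [shift, add_sub_assoc]
    rw [Finset.sum_add_distrib, sum_coboundary_odd, hm.sum_odd f hf, add_zero]

/-- The perfect matching with a given height function. -/
def ofHeight (hm : IsMatchingFun H m) (φ : heightLattice H m) : PerfectMatching H :=
  (isMatchingFun_shift hm φ.2).toMatching

theorem bond_mem_ofHeight (hm : IsMatchingFun H m) {φ : heightLattice H m} {d : Fin 3}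
    {f : ℤ × ℤ} : bond d f ∈ (ofHeight hm φ).1.edgeSet ↔ shift m φ.1 d f = 1 :=
  (isMatchingFun_shift hm φ.2).bond_mem_toMatching

theorem eq_zero_of_ray {D : ℤ × ℤ → ℤ} (hD : D.support.Finite) {u : ℕ → ℤ × ℤ}
    (hu : Function.Injective u) (h : ∀ n, D (u n) = D (u (n + 1))) : D (u 0) = 0 := by
  by_contra hne
  refine Set.infinite_of_injective_forall_mem hu (fun n => ?_) hD
  have key : ∀ n, D (u 0) = D (u n) := by
    intro n
    induction n with
    | zero => rfl
    | succ n ih => exact ih.trans (h n)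
  change D (u n) ≠ 0
  rwa [← key n]

/-- A function of finite support on the faces that changes only at `h` vanishes off `h`. -/
theorem eq_zero_of_ne {D : ℤ × ℤ → ℤ} (hD : D.support.Finite) {h : ℤ × ℤ}
    (hstep : ∀ f, f ≠ h → f + (1, 0) ≠ h → D f = D (f + (1, 0))) {g : ℤ × ℤ} (hg : g ≠ h) :
    D g = 0 := by
  obtain ⟨a, b⟩ := g
  obtain ⟨x, y⟩ := h
  rw [Ne, Prod.mk.injEq, not_and_or] at hg
  -- Of the two horizontal rays from `g`, follow one that avoids `h`.
  by_cases hr : b ≠ y ∨ x < a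
  · have := eq_zero_of_ray hD (u := fun n => (a + n, b)) (fun n k hnk => by simpa using hnk)
      (fun n => by
        have := hstep (a + n, b) (by simp only [Ne, Prod.mk.injEq]; omega)
          (by simp only [Prod.mk_add_mk, Ne, Prod.mk.injEq]; omega)
        rw [this]
        simp [add_assoc])
    simpa using this
  · have := eq_zero_of_ray hD (u := fun n => (a - n, b)) (fun n k hnk => by simpa using hnk)
      (fun n => by
        have := hstep (a - (n + 1), b) (by simp only [Ne, Prod.mk.injEq]; omega)
          (by simp only [Prod.mk_add_mk, Ne, Prod.mk.injEq]; omega)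
        push_cast
        rw [this]
        congr 1
        simp only [Prod.mk_add_mk, Prod.mk.injEq]
        constructor <;> ring)
    simpa using this

theorem finite_support_of_mem (hH : HasNoHoles H) (φ : heightLattice H m) :
    φ.1.support.Finite :=
  hH.finite_faces.subset fun f hf => not_not.1 (mt (φ.2.1 f) hf)

theorem finite_support_sub (hH : HasNoHoles H) (φ ψ : heightLattice H m) :
    (φ.1 - ψ.1).support.Finite :=
  ((finite_support_of_mem hH φ).union (finite_support_of_mem hH ψ)).subset
    (Function.support_sub _ _)

theorem shift_sub_shift (φ ψ : ℤ × ℤ → ℤ) (d : Fin 3) (f : ℤ × ℤ) :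
    shift m φ d f - shift m ψ d f = (φ - ψ) (posFace d f) - (φ - ψ) (negFace d f) := by
  simp only [shift, Pi.sub_apply]
  ring

theorem horizontal_step (f : ℤ × ℤ) :
    posFace 2 (f + (1, 0)) = f ∧ negFace 2 (f + (1, 0)) = f + (1, 0) := by
  obtain ⟨a, b⟩ := f
  simp [posFace, negFace]

theorem shift_eq_iff (hm : IsMatchingFun H m) (φ ψ : heightLattice H m) (d : Fin 3) (f : ℤ × ℤ) :
    shift m φ.1 d f = shift m ψ.1 d f ↔
      (bond d f ∈ (ofHeight hm φ).1.edgeSet ↔ bond d f ∈ (ofHeight hm ψ).1.edgeSet) := by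
  rw [bond_mem_ofHeight, bond_mem_ofHeight]
  have := φ.2.2 d f
  have := ψ.2.2 d f
  omega

/-- Two heights of the same matching differ by a function that is constant across all bonds and has
finite support, hence by zero. -/
theorem ofHeight_injective (hH : HasNoHoles H) (hm : IsMatchingFun H m) :
    Function.Injective (ofHeight hm) := by
  intro φ ψ h
  have hs : ∀ d f, (φ.1 - ψ.1) (posFace d f) = (φ.1 - ψ.1) (negFace d f) := by
    intro d f
    have h1 := shift_sub_shift (m := m) φ.1 ψ.1 d f
    rw [(shift_eq_iff hm φ ψ d f).2 (by rw [h]), sub_self] at h1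
    linarith
  refine Subtype.ext (sub_eq_zero.1 (funext fun g => ?_))
  refine eq_zero_of_ne (finite_support_sub hH φ ψ) (h := g + (1, 0)) (fun f _ _ => ?_) (by simp)
  have := hs 2 (f + (1, 0))
  rwa [(horizontal_step f).1, (horizontal_step f).2] at this

theorem IsMatchingFun.eq_zero (hm : IsMatchingFun H m) {d : Fin 3} {f : ℤ × ℤ}
    (h : bond d f ∉ H.edgeSet) : m d f = 0 :=
  (hm.zero_or_one d f).resolve_right fun h' => h (hm.mem d f h')

theorem evenV_mem_of_bond {d : Fin 3} {f : ℤ × ℤ} (h : bond d f ∈ H.edgeSet) :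
    evenV f ∈ H.verts := H.edge_vert h

theorem oddV_mem_of_bond {d : Fin 3} {f : ℤ × ℤ} (h : bond d (f - off d) ∈ H.edgeSet) :
    oddV f ∈ H.verts := by
  rw [bond, sub_add_cancel, Sym2.eq_swap] at h
  exact H.edge_vert h

theorem IsMatchingFun.sum_even_eq (hm : IsMatchingFun H m) {m' : Fin 3 → ℤ × ℤ → ℤ}
    (hm' : IsMatchingFun H m') (f : ℤ × ℤ) : ∑ d, m d f = ∑ d, m' d f := by
  by_cases hf : evenV f ∈ H.verts
  · rw [hm.sum_even f hf, hm'.sum_even f hf]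
  · refine Finset.sum_congr rfl fun d _ => ?_
    have : bond d f ∉ H.edgeSet := fun h => hf (evenV_mem_of_bond h)
    rw [hm.eq_zero this, hm'.eq_zero this]

theorem IsMatchingFun.sum_odd_eq (hm : IsMatchingFun H m) {m' : Fin 3 → ℤ × ℤ → ℤ}
    (hm' : IsMatchingFun H m') (f : ℤ × ℤ) :
    ∑ d, m d (f - off d) = ∑ d, m' d (f - off d) := by
  by_cases hf : oddV f ∈ H.verts
  · rw [hm.sum_odd f hf, hm'.sum_odd f hf]
  · refine Finset.sum_congr rfl fun d _ => ?_
    have : bond d (f - off d) ∉ H.edgeSet := fun h => hf (oddV_mem_of_bond h)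
    rw [hm.eq_zero this, hm'.eq_zero this]

theorem IsMatchingFun.finite_support (hm : IsMatchingFun H m) (hH : HasNoHoles H) (d : Fin 3) :
    (m d).support.Finite := by
  refine (hH.finite_verts.preimage evenV_injective.injOn).subset fun f hf => ?_
  exact evenV_mem_of_bond (hm.mem d f ((hm.zero_or_one d f).resolve_left hf))

/-- The difference of two matchings is closed at every vertex, which gives a face potential. It does
not change across bonds outside `H`, so the absence of holes makes it vanish off `H`. -/
theorem ofHeight_surjective (hH : HasNoHoles H) (hm : IsMatchingFun H m) :
    Function.Surjective (ofHeight hm) := by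
  intro M
  have hM := isMatchingFun_bondInd M
  obtain ⟨φ, hfin, hφ⟩ := exists_face_potential (m := fun d f => bondInd M.1 d f - m d f)
    (fun d => ((hM.finite_support hH d).union (hm.finite_support hH d)).subset
      (Function.support_sub _ _))
    (fun f => by rw [Finset.sum_sub_distrib, hM.sum_even_eq hm, sub_self])
    (fun f => by rw [Finset.sum_sub_distrib, hM.sum_odd_eq hm, sub_self])
  have hs : shift m φ = bondInd M.1 := by
    funext d f
    have := hφ d f
    rw [shift]
    linarith
  have hmem : φ ∈ heightLattice H m := by
    refine ⟨hH.eq_zero φ hfin fun f g e _ _ hef heg he => ?_, fun d f => ?_⟩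
    · obtain ⟨d, k, rfl⟩ := exists_bond (hexEdges_subset f hef)
      have := hφ d k
      rw [hM.eq_zero he, hm.eq_zero he] at this
      rcases bond_mem_hexEdges.1 hef with rfl | rfl <;>
        rcases bond_mem_hexEdges.1 heg with rfl | rfl <;> linarith
    · rw [hs]
      have := hM.zero_or_one d f
      omega
  refine ⟨⟨φ, hmem⟩, PerfectMatching.ext_bond fun d f => ?_⟩
  rw [bond_mem_ofHeight, hs, bondInd_eq_one]

end Benzenoid

namespace Benzenoid

variable {H : hexLattice.Subgraph} {m : Fin 3 → ℤ × ℤ → ℤ}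

/-! ## Cover relations and proper sextets -/

theorem negFace_eq_posFace_add_one (d : Fin 3) (f : ℤ × ℤ) : negFace d f = posFace (d + 1) f := by
  fin_cases d <;> rfl

/-- The sides with odd index of a face are not in a matching containing those with even index. -/
theorem IsMatchingFun.eq_zero_of_negFace (hm : IsMatchingFun H m) {h : ℤ × ℤ}
    (hpos : ∀ d f, posFace d f = h → m d f = 1) {d : Fin 3} {f : ℤ × ℤ} (hf : negFace d f = h) :
    m d f = 0 := by
  have h1 := hpos (d + 1) f (by rw [← negFace_eq_posFace_add_one, hf])
  have h2 := (sum_eq_one_iff fun d => hm.zero_or_one d f).1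
    (hm.sum_even f (evenV_mem_of_bond (hm.mem _ f h1)))
  refine (hm.zero_or_one d f).resolve_right fun h3 => ?_
  have := h2.unique h1 h3
  fin_cases d <;> simp at this

/-- Lowering the height at `h` removes the even sides of `h` from the matching and adds the odd
ones. Once all even sides are matched, the odd ones are automatically free. -/
theorem sub_single_mem_iff (hm : IsMatchingFun H m) (φ : heightLattice H m) {h : ℤ × ℤ} :
    φ.1 - Pi.single h 1 ∈ heightLattice H m ↔
      hexagon h ≤ H ∧ ∀ d f, posFace d f = h → shift m φ.1 d f = 1 := by
  have hsub : ∀ d f, shift m (φ.1 - Pi.single h 1) d f = shift m φ.1 d f -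
      (Pi.single h 1 : ℤ × ℤ → ℤ) (posFace d f) + (Pi.single h 1 : ℤ × ℤ → ℤ) (negFace d f) := by
    intro d f
    simp only [shift, Pi.sub_apply]
    ring
  constructor
  · intro hmem
    refine ⟨?_, fun d f hf => ?_⟩
    · by_contra hh
      have h1 := hmem.1 h hh
      rw [Pi.sub_apply, φ.2.1 h hh, Pi.single_eq_same] at h1
      omega
    · have h1 := hmem.2 d f
      have h2 := φ.2.2 d f
      rw [hsub, hf, Pi.single_eq_same,
        Pi.single_eq_of_ne (by rw [← hf]; exact (posFace_ne_negFace d f).symm)] at h1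
      omega
  · rintro ⟨hh, hpos⟩
    refine ⟨fun f hf => ?_, fun d f => ?_⟩
    · rw [Pi.sub_apply, φ.2.1 f hf, Pi.single_eq_of_ne (by rintro rfl; exact hf hh)]
      rfl
    · rw [hsub]
      by_cases h1 : posFace d f = h
      · rw [h1, Pi.single_eq_same, hpos d f h1,
          Pi.single_eq_of_ne (by rw [← h1]; exact (posFace_ne_negFace d f).symm)]
        omega
      · rw [Pi.single_eq_of_ne h1]
        by_cases h2 : negFace d f = h
        · rw [h2, Pi.single_eq_same,
            (isMatchingFun_shift hm φ.2).eq_zero_of_negFace hpos h2]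
          omega
        · rw [Pi.single_eq_of_ne h2]
          have := φ.2.2 d f
          omega

theorem exists_sub_single_mem (hH : HasNoHoles H) (hm : IsMatchingFun H m)
    {φ ψ : heightLattice H m} (h : ψ < φ) :
    ∃ k, φ.1 - Pi.single k 1 ∈ heightLattice H m ∧ ψ.1 ≤ φ.1 - Pi.single k 1 := by
  have hle : ψ.1 ≤ φ.1 := h.le
  obtain ⟨g, hg⟩ : ∃ g, ψ.1 g < φ.1 g := by
    by_contra! hcon
    exact h.not_ge hcon
  have hgH : hexagon g ≤ H := by
    by_contra hgH
    rw [φ.2.1 g hgH, ψ.2.1 g hgH] at hg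
    exact hg.false
  obtain ⟨f₀, hf₀, hmax⟩ := hH.finite_faces.exists_maximalFor (φ.1 - ψ.1) _ ⟨g, hgH⟩
  have hmax' : ∀ f, (φ.1 - ψ.1) f ≤ (φ.1 - ψ.1) f₀ := by
    intro f
    by_cases hf : hexagon f ≤ H
    · exact (le_total _ _).elim id (hmax hf)
    · rw [Pi.sub_apply, φ.2.1 f hf, ψ.2.1 f hf, sub_self]
      exact sub_nonneg.2 (hle f₀)
  have hpos : 0 < (φ.1 - ψ.1) f₀ := (sub_pos.2 hg).trans_le (hmax' g)
  -- Take the faces where `φ - ψ` is maximal. Across their boundary `φ - ψ` drops by at least one,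
  -- which forces value `1` for `φ` and `0` for `ψ` on the even boundary sides. As the maximum is
  -- positive, lowering `φ` there stays above `ψ`.
  obtain ⟨k, hk, hsides⟩ := exists_alternating_face hH (isMatchingFun_shift hm φ.2)
    (S := {f | (φ.1 - ψ.1) f = (φ.1 - ψ.1) f₀}) ⟨f₀, rfl⟩
    (fun f hf => by
      by_contra hfH
      have hf' : (φ.1 - ψ.1) f = (φ.1 - ψ.1) f₀ := hf
      rw [Pi.sub_apply, φ.2.1 f hfH, ψ.2.1 f hfH] at hf'
      omega)
    (fun d f h1 h2 => by
      have h1' : (φ.1 - ψ.1) (posFace d f) = (φ.1 - ψ.1) f₀ := h1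
      have h2' := lt_of_le_of_ne (hmax' (negFace d f)) h2
      have h3 := shift_sub_shift (m := m) φ.1 ψ.1 d f
      have h4 := φ.2.2 d f
      have h5 := ψ.2.2 d f
      omega)
  have hkH : hexagon k ≤ H := by
    by_contra hkH
    have hk' : (φ.1 - ψ.1) k = (φ.1 - ψ.1) f₀ := hk
    rw [Pi.sub_apply, φ.2.1 k hkH, ψ.2.1 k hkH] at hk'
    omega
  refine ⟨k, (sub_single_mem_iff hm φ).2 ⟨hkH, hsides⟩, fun f => ?_⟩
  rw [Pi.sub_apply]
  by_cases hf : f = k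
  · subst hf
    have hk' : (φ.1 - ψ.1) f = (φ.1 - ψ.1) f₀ := hk
    rw [Pi.sub_apply] at hk'
    rw [Pi.single_eq_same]
    change ψ.1 f ≤ φ.1 f - 1; linarith
  · rw [Pi.single_eq_of_ne hf, sub_zero]
    exact hle f

theorem covBy_iff (hH : HasNoHoles H) (hm : IsMatchingFun H m) {φ ψ : heightLattice H m} :
    ψ ⋖ φ ↔ ∃ k, ψ.1 = φ.1 - Pi.single k 1 := by
  have hnn : ∀ k f : ℤ × ℤ, 0 ≤ (Pi.single k 1 : ℤ × ℤ → ℤ) f := by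
    intro k f
    by_cases hf : f = k
    · rw [hf, Pi.single_eq_same]; omega
    · rw [Pi.single_eq_of_ne hf]
  constructor
  · intro h
    obtain ⟨k, hk, hle⟩ := exists_sub_single_mem hH hm h.lt
    refine ⟨k, ?_⟩
    rcases h.eq_or_eq (c := ⟨_, hk⟩) hle (fun f => sub_le_self _ (hnn k f)) with h' | h'
    · exact (congrArg Subtype.val h').symm
    · have := congrFun (congrArg Subtype.val h') k
      simp at this
  · rintro ⟨k, hk⟩
    refine ⟨lt_of_le_not_ge (fun f => ?_) fun hge => ?_, fun χ h1 h2 => ?_⟩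
    · change ψ.1 f ≤ φ.1 f
      rw [hk]
      exact sub_le_self _ (hnn k f)
    · have h1 : φ.1 k ≤ ψ.1 k := hge k
      rw [hk, Pi.sub_apply, Pi.single_eq_same] at h1
      omega
    · have hoff : ∀ f, f ≠ k → ψ.1 f = φ.1 f := by
        intro f hf
        rw [hk, Pi.sub_apply, Pi.single_eq_of_ne hf, sub_zero]
      have hkk : ψ.1 k = φ.1 k - 1 := by
        rw [hk, Pi.sub_apply, Pi.single_eq_same]
      have h1k : ψ.1 k ≤ χ.1 k := h1.le k
      have h2k : χ.1 k ≤ φ.1 k := h2.le k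
      rcases h1k.eq_or_lt with h3 | h3
      · refine h1.not_ge fun f => ?_
        by_cases hf : f = k
        · subst hf; exact h3.ge
        · exact (h2.le f).trans (hoff f hf).ge
      · refine h2.not_ge fun f => ?_
        by_cases hf : f = k
        · subst hf
          change φ.1 f ≤ χ.1 f
          omega
        · exact (hoff f hf).ge.trans (h1.le f)

theorem symmDiff_edgeSet_eq_iff (hm : IsMatchingFun H m) (φ ψ : heightLattice H m) (k : ℤ × ℤ) :
    symmDiff (ofHeight hm φ).1.edgeSet (ofHeight hm ψ).1.edgeSet = hexEdges k ↔
      ∀ d f, shift m φ.1 d f = shift m ψ.1 d f ↔ k ≠ posFace d f ∧ k ≠ negFace d f := by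
  have key : ∀ d f, bond d f ∈ symmDiff (ofHeight hm φ).1.edgeSet (ofHeight hm ψ).1.edgeSet ↔
      shift m φ.1 d f ≠ shift m ψ.1 d f := by
    intro d f
    rw [Ne, shift_eq_iff hm, Set.mem_symmDiff]
    tauto
  constructor
  · intro h d f
    have := key d f
    rw [h, bond_mem_hexEdges] at this
    tauto
  · intro h
    ext e
    by_cases he : e ∈ hexLattice.edgeSet
    · obtain ⟨d, f, rfl⟩ := exists_bond he
      rw [key, Ne, h, bond_mem_hexEdges]
      tauto
    · refine iff_of_false (fun h' => he ?_) fun h' => he (hexEdges_subset k h')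
      rcases h' with h' | h'
      exacts [SimpleGraph.Subgraph.edgeSet_subset _ h'.1,
        SimpleGraph.Subgraph.edgeSet_subset _ h'.1]

theorem adj_of_eq_sub_single (hm : IsMatchingFun H m) {φ ψ : heightLattice H m} {k : ℤ × ℤ}
    (h : ψ.1 = φ.1 - Pi.single k 1) :
    (resonanceGraph H).Adj (ofHeight hm φ) (ofHeight hm ψ) := by
  have hk := ((sub_single_mem_iff hm φ).1 (h ▸ ψ.2)).1
  refine ⟨k, hk, (symmDiff_edgeSet_eq_iff hm φ ψ k).2 fun d f => ?_⟩
  rw [← sub_eq_zero, shift_sub_shift, h, sub_sub_cancel]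
  have hne := posFace_ne_negFace d f
  by_cases h1 : k = posFace d f
  · subst h1
    rw [Pi.single_eq_same, Pi.single_eq_of_ne hne.symm]
    simp
  · rw [Pi.single_eq_of_ne (Ne.symm h1)]
    by_cases h2 : k = negFace d f
    · subst h2
      rw [Pi.single_eq_same]
      simp
    · rw [Pi.single_eq_of_ne (Ne.symm h2)]
      simp [h1, h2]

/-- If the matchings differ exactly on the hexagon `k`, then `φ - ψ` changes only across the sides
of `k`. So it vanishes off `k`, and at `k` it is `1` or `-1`. -/
theorem adj_ofHeight_iff (hH : HasNoHoles H) (hm : IsMatchingFun H m) {φ ψ : heightLattice H m} :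
    (resonanceGraph H).Adj (ofHeight hm φ) (ofHeight hm ψ) ↔ φ ⋖ ψ ∨ ψ ⋖ φ := by
  rw [covBy_iff hH hm, covBy_iff hH hm]
  constructor
  · rintro ⟨k, -, hk⟩
    rw [symmDiff_edgeSet_eq_iff] at hk
    have hoff : ∀ g, g ≠ k → (φ.1 - ψ.1) g = 0 := by
      intro g hg
      refine eq_zero_of_ne (finite_support_sub hH φ ψ) (fun f h1 h2 => ?_) hg
      obtain ⟨e1, e2⟩ := horizontal_step f
      have h3 := (hk 2 (f + (1, 0))).2 (by rw [e1, e2]; exact ⟨h1.symm, h2.symm⟩)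
      have h4 := shift_sub_shift (m := m) φ.1 ψ.1 2 (f + (1, 0))
      rw [e1, e2] at h4
      linarith
    obtain ⟨e1, e2⟩ := horizontal_step k
    have h3 := hk 2 (k + (1, 0))
    have h4 := shift_sub_shift (m := m) φ.1 ψ.1 2 (k + (1, 0))
    have h5 := φ.2.2 2 (k + (1, 0))
    have h6 := ψ.2.2 2 (k + (1, 0))
    rw [e1, e2, hoff (k + (1, 0)) (by simp)] at h4
    have h7 : shift m φ.1 2 (k + (1, 0)) ≠ shift m ψ.1 2 (k + (1, 0)) := fun h =>
      (h3.1 h).1 e1.symm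
    rw [Pi.sub_apply] at h4
    have h8 : ∀ φ' ψ' : ℤ × ℤ → ℤ, (∀ g, g ≠ k → φ' g = ψ' g) → φ' k - ψ' k = 1 →
        ψ' = φ' - Pi.single k 1 := by
      intro φ' ψ' h h'
      funext g
      rw [Pi.sub_apply]
      by_cases hg : g = k
      · subst hg
        rw [Pi.single_eq_same]
        omega
      · rw [Pi.single_eq_of_ne hg, h g hg, sub_zero]
    rcases (by omega : φ.1 k - ψ.1 k = 1 ∨ ψ.1 k - φ.1 k = 1) with h | h
    · exact Or.inr ⟨k, h8 _ _ (fun g hg => sub_eq_zero.1 (hoff g hg)) h⟩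
    · exact Or.inl ⟨k, h8 _ _ (fun g hg => (sub_eq_zero.1 (hoff g hg)).symm) h⟩
  · rintro (⟨k, hk⟩ | ⟨k, hk⟩)
    · exact (adj_of_eq_sub_single hm hk).symm
    · exact adj_of_eq_sub_single hm hk

/-- The right vertical side has even index `2`, so in a proper sextet the matched sides are the even
ones, which is the condition for lowering the height at `k`. -/
theorem isProperSextet_iff (hm : IsMatchingFun H m) (φ : heightLattice H m) (k : ℤ × ℤ) :
    IsProperSextet H (ofHeight hm φ) k ↔ φ.1 - Pi.single k 1 ∈ heightLattice H m := by
  rw [sub_single_mem_iff hm]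
  have hs := isMatchingFun_shift hm φ.2
  have hedge : ∀ j, hexEdge k j ∈ (ofHeight hm φ).1.edgeSet ↔
      shift m φ.1 (![0, 1, 2, 0, 1, 2] j)
        (k + ![(0, 0), (1, 0), (1, 0), (0, 1), (0, 1), (0, 0)] j) = 1 := by
    intro j
    rw [hexEdge_eq_bond, bond_mem_ofHeight]
  refine and_congr_right fun hk => ?_
  rw [IsAlternating]
  constructor
  · rintro ⟨halt, h2⟩ d f rfl
    have a1 := halt 1
    have a2 := halt 2
    have a3 := halt 3
    have a0 := halt 0
    have h4 : hexEdge (posFace d f) 4 ∈ (ofHeight hm φ).1.edgeSet := by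
      change hexEdge _ 2 ∈ _ ↔ hexEdge _ 3 ∉ _ at a2
      change hexEdge _ 3 ∈ _ ↔ hexEdge _ 4 ∉ _ at a3
      tauto
    have h0 : hexEdge (posFace d f) 0 ∈ (ofHeight hm φ).1.edgeSet := by
      change hexEdge _ 0 ∈ _ ↔ hexEdge _ 1 ∉ _ at a0
      change hexEdge _ 1 ∈ _ ↔ hexEdge _ 2 ∉ _ at a1
      tauto
    rw [hedge] at h0 h2 h4
    obtain ⟨a, b⟩ := f
    fin_cases d
    · simpa [posFace] using h0
    · simpa [posFace] using h4
    · simpa [posFace] using h2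
  · intro hpos
    have hneg := fun {d f} => hs.eq_zero_of_negFace hpos (d := d) (f := f)
    obtain ⟨a, b⟩ := k
    have p0 := hpos 0 (a, b) (by simp [posFace])
    have p1 := hpos 1 (a, b + 1) (by simp [posFace])
    have p2 := hpos 2 (a + 1, b) (by simp [posFace])
    have n0 := hneg (d := 0) (f := (a, b + 1)) (by simp [negFace])
    have n1 := hneg (d := 1) (f := (a + 1, b)) (by simp [negFace])
    have n2 := hneg (d := 2) (f := (a, b)) (by simp [negFace])
    constructor
    · intro j
      rw [hedge, hedge]
      fin_cases j <;> simp [p0, p1, p2, n0, n1, n2]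
    · rw [hedge]
      simp [p2]

theorem ncard_properSextets (hH : HasNoHoles H) (hm : IsMatchingFun H m)
    (φ : heightLattice H m) :
    {k | IsProperSextet H (ofHeight hm φ) k}.ncard = {ψ | ψ ⋖ φ}.ncard := by
  refine Set.ncard_congr
    (fun k hk => ⟨φ.1 - Pi.single k 1, (isProperSextet_iff hm φ k).1 hk⟩) ?_ ?_ ?_
  · exact fun k hk => (covBy_iff hH hm).2 ⟨k, rfl⟩
  · intro k l hk hl h
    have h1 : (Pi.single k 1 : ℤ × ℤ → ℤ) = Pi.single l 1 :=
      sub_right_injective (congrArg Subtype.val h)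
    by_contra hkl
    have := congrFun h1 k
    rw [Pi.single_eq_same, Pi.single_eq_of_ne hkl] at this
    omega
  · intro ψ hψ
    obtain ⟨k, hk⟩ := (covBy_iff hH hm).1 hψ
    exact ⟨k, (isProperSextet_iff hm φ k).2 (hk ▸ ψ.2), Subtype.ext hk.symm⟩

end Benzenoid

/-! ### The corollary: the resonance graph as the cover graph of the height lattice -/

theorem corollary4p12 (H : Benzenoid.hexLattice.Subgraph) (hH : Benzenoid.IsHexagonalSystem H)
    (hK : Benzenoid.IsKekulean H) (i : ℕ) :
    i.factorial * Benzenoid.numMatchingsWithProperSextets H i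
      = CubeDerivative.theta (Benzenoid.resonanceGraph H) i := by
  obtain ⟨M⟩ := hK
  have hH' := hH.hasNoHoles
  have hm := Benzenoid.isMatchingFun_bondInd M
  let E := Equiv.ofBijective (Benzenoid.ofHeight hm)
    ⟨Benzenoid.ofHeight_injective hH' hm, Benzenoid.ofHeight_surjective hH' hm⟩
  have := hH'.finite_perfectMatching
  have : Finite (Benzenoid.heightLattice H (Benzenoid.bondInd M.1)) := Finite.of_equiv _ E.symm
  have : Nonempty (Benzenoid.heightLattice H (Benzenoid.bondInd M.1)) := ⟨E.symm M⟩
  let e : SimpleGraph.hasse (Benzenoid.heightLattice H (Benzenoid.bondInd M.1)) ≃g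
      Benzenoid.resonanceGraph H := ⟨E, Benzenoid.adj_ofHeight_iff hH' hm⟩
  rw [DownSetGraph.theta_hasse e.symm, Benzenoid.numMatchingsWithProperSextets]
  congr 1
  refine Nat.card_congr (E.subtypeEquiv fun φ => ?_).symm
  rw [← Benzenoid.ncard_properSextets hH' hm φ]
  rfl
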